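/- Let $\Sigma$ be a compact connected oriented smooth surface with nonempty boundary and $I=[0,1]$. Let $(M,\alpha)$ be a homology cobordism of $\Sigma$: $M$ is a compact connected oriented smooth $3$-manifold with boundary and $\alpha:\partial(\Sigma\times I)\to\partial M$ is a homeomorphism (for instance a diffeomorphism, after rounding the corners of $\Sigma\times I$) such that the maps $\alpha_0,\alpha_1:\Sigma\to M$, $\alpha_i(p)=\alpha(p,i)$, induce isomorphisms $\alpha_{i*}:H_1(\Sigma,\mathbb Z)\to H_1(M,\mathbb Z)$. For a space $X$ and $x,y\in X$ let $\pi_1(X,x,y)$ be the set of homotopy classes, relative to the endpoints, of paths from $x$ to $y$, let $\mathbb Q\pi_1(X,x,y)$ be the $\mathbb Q$-vector space with basis $\pi_1(X,x,y)$, on which the group ring $\mathbb Q\pi_1(X,x)$ acts from the left by concatenation, and let $\varepsilon:\mathbb Q\pi_1(X,x)\to\mathbb Q$ be the augmentation. Put $F^n\mathbb Q\pi_1(X,x,y)=(\ker\varepsilon)^n\,\mathbb Q\pi_1(X,x,y)$ and $$\widehat{\mathbb Q\pi_1}(X,x,y)=\varprojlim_n \mathbb Q\pi_1(X,x,y)/F^n\mathbb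 Q\pi_1(X,x,y),\qquad F^n\widehat{\mathbb Q\pi_1}(X,x,y)=\ker\bigl(\widehat{\mathbb Q\pi_1}(X,x,y)\to\mathbb Q\pi_1(X,x,y)/F^n\mathbb Q\pi_1(X,x,y)\bigr).$$ For $\star\in\partial\Sigma$ let $\gamma_{01\star}$ be the class of the path $t\mapsto\alpha(\star,t)$ in $M$, and $\gamma_{10\star}$ that of its reverse. For $\star_1,\star_2\in\partial\Sigma$ let $$\diamond:\widehat{\mathbb Q\pi_1}(M,\alpha(\star_1,0),\alpha(\star_2,0))\to\widehat{\mathbb Q\pi_1}(M,\alpha(\star_1,1),\alpha(\star_2,1))$$ be induced by $\gamma\mapsto\gamma_{10\star_1}\gamma\,\gamma_{01\star_2}$, and let $(M,\alpha)_*=\alpha_{1*}^{-1}\circ\diamond\circ\alpha_{0*}$ be the resulting action on $\widehat{\mathbb Q\pi_1}(\Sigma,\star_1,\star_2)$, where $\alpha_{0*}$ and $\alpha_{1*}$ are the maps that $\alpha_0$ and $\alpha_1$ induce on completions ($\alpha_{1*}$ is invertible by Stallings' theorem). **Proposition 4.2.** The following two conditions are equivalent. 1. $\ker\bigl(\iota_*:H_1(\partial(\Sigma\times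 I),\mathbb Z)\to H_1(\Sigma\times I,\mathbb Z)\bigr)=\ker\bigl(\alpha_*:H_1(\partial(\Sigma\times I),\mathbb Z)\to H_1(M,\mathbb Z)\bigr)$, where $\iota$ is the inclusion and $\alpha$ is regarded as a map to $M$. 2. For all $\star_1,\star_2\in\partial\Sigma$, $$\bigl((M,\alpha)_*-\mathrm{id}\bigr)\bigl(\widehat{\mathbb Q\pi_1}(\Sigma,\star_1,\star_2)\bigr)\subset F^2\,\widehat{\mathbb Q\pi_1}(\Sigma,\star_1,\star_2).$$ -/

import Mathlib

open scoped Manifold ContDiff unitInterval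

universe u

noncomputable section

namespace HomologyCobordism

/-! ### First singular homology with integer coefficients -/

section Homology

variable {X Y : Type u} [TopologicalSpace X] [TopologicalSpace Y]

/-- `H₁(X; ℤ)`, singular homology (the coefficient group is `ℤ`, lifted to the universe of `X`). -/
def H1 (X : Type u) [TopologicalSpace X] : ModuleCat.{u} ℤ :=
  ((AlgebraicTopology.singularHomologyFunctor (ModuleCat.{u} ℤ) 1).obj
    (ModuleCat.of ℤ (ULift.{u} ℤ))).obj (TopCat.of X)

/-- The homomorphism `f_* : H₁(X; ℤ) → H₁(Y; ℤ)` induced by a continuous map. -/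
def H1map (f : C(X, Y)) : H1 X →ₗ[ℤ] H1 Y :=
  (((AlgebraicTopology.singularHomologyFunctor (ModuleCat.{u} ℤ) 1).obj
    (ModuleCat.of ℤ (ULift.{u} ℤ))).map (TopCat.ofHom f)).hom

end Homology

/-! ### The vector spaces `ℚπ₁(X, x, y)`, their filtrations and completions -/

section PathModule

variable {X Y : Type*} [TopologicalSpace X] [TopologicalSpace Y]

/-- `ℚπ₁(X, x, y)`: the free `ℚ`-vector space on the set `π₁(X, x, y)` of homotopy classes,
relative to the endpoints, of paths from `x` to `y`. For `x = y` it is the group ring. -/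
abbrev QPi (x y : X) : Type _ := Path.Homotopic.Quotient x y →₀ ℚ

/-- The bilinear extension of the concatenation of paths (first `p`, then `q`). For `x = y` it is
the multiplication of the group ring `ℚπ₁(X, x)` if `y = z`, and its left action on
`ℚπ₁(X, x, z)` in general. -/
def concat (x y z : X) : QPi x y →ₗ[ℚ] QPi y z →ₗ[ℚ] QPi x z :=
  Finsupp.linearCombination ℚ fun p => Finsupp.lmapDomain ℚ ℚ fun q => p.trans q

/-- The augmentation, `∑ c_γ γ ↦ ∑ c_γ`. -/
def augmentation (x y : X) : QPi x y →ₗ[ℚ] ℚ :=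
  Finsupp.linearCombination ℚ fun _ => (1 : ℚ)

/-- `Fⁿℚπ₁(X, x, y) = (ker ε)ⁿ ℚπ₁(X, x, y)`, where `ε` is the augmentation of `ℚπ₁(X, x)`:
`(ker ε)⁰ V = V` and `(ker ε)ⁿ⁺¹ V` is the span of the products `a b` with `a ∈ ker ε` and
`b ∈ (ker ε)ⁿ V`. -/
def filtration (x y : X) : ℕ → Submodule ℚ (QPi x y)
  | 0 => ⊤
  | n + 1 => Submodule.map₂ (concat x x y) (LinearMap.ker (augmentation x x)) (filtration x y n)

theorem filtration_succ_le (x y : X) (n : ℕ) : filtration x y (n + 1) ≤ filtration x y n := by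
  induction n with
  | zero => exact le_top
  | succ n ih => exact Submodule.map₂_le_map₂_right ih

theorem filtration_antitone (x y : X) : Antitone (filtration x y) :=
  antitone_nat_of_succ_le (filtration_succ_le x y)

/-- The completion of `ℚπ₁(X, x, y)`: the inverse limit of the quotients
`ℚπ₁(X, x, y) / Fⁿℚπ₁(X, x, y)`, as the space of compatible families. -/
def Completion (x y : X) : Submodule ℚ (∀ n, QPi x y ⧸ filtration x y n) where
  carrier := {v | ∀ m n (h : m ≤ n), Submodule.factor (filtration_antitone x y h) (v n) = v m}
  zero_mem' := fun m n h => by simp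
  add_mem' := fun {v w} hv hw m n h => by simp [hv m n h, hw m n h]
  smul_mem' := fun c v hv m n h => by simp [hv m n h]

/-- The filtration of the completion: `Fⁿ` is the kernel of the projection to
`ℚπ₁(X, x, y) / Fⁿℚπ₁(X, x, y)`. -/
def completionFiltration (x y : X) (n : ℕ) : Submodule ℚ (Completion x y) :=
  LinearMap.ker ((LinearMap.proj n).comp (Completion x y).subtype)

/-- The map of completions induced by a linear map that preserves the filtrations. -/
def completionMap {x y : X} {x' y' : Y} (φ : QPi x y →ₗ[ℚ] QPi x' y')
    (hφ : ∀ n, filtration x y n ≤ (filtration x' y' n).comap φ) :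
    Completion x y →ₗ[ℚ] Completion x' y' :=
  ((LinearMap.pi fun n =>
      (Submodule.mapQ _ _ φ (hφ n)).comp (LinearMap.proj n)).comp
        (Completion x y).subtype).codRestrict (Completion x' y') (by
    rintro ⟨v, hv⟩ m n h
    simp only [LinearMap.comp_apply, LinearMap.pi_apply, Submodule.subtype_apply,
      LinearMap.proj_apply]
    rw [← hv m n h]
    obtain ⟨w, hw⟩ := Submodule.mkQ_surjective _ (v n)
    rw [← hw]
    rfl)

theorem concat_single (x y z : X) (p : Path.Homotopic.Quotient x y)
    (q : Path.Homotopic.Quotient y z) (c d : ℚ) :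
    concat x y z (Finsupp.single p c) (Finsupp.single q d) =
      Finsupp.single (p.trans q) (c * d) := by
  simp [concat, Finsupp.mapDomain_single]

/-- A linear map that is compatible with the left actions, along a linear map of group rings that
preserves the augmentation, preserves the filtrations. -/
theorem filtration_le_comap {x y : X} {x' y' : Y} (ψ : QPi x x →ₗ[ℚ] QPi x' x')
    (φ : QPi x y →ₗ[ℚ] QPi x' y')
    (hψ : (augmentation x' x').comp ψ = augmentation x x)
    (h : ∀ a b, φ (concat x x y a b) = concat x' x' y' (ψ a) (φ b)) (n : ℕ) :
    filtration x y n ≤ (filtration x' y' n).comap φ := by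
  induction n with
  | zero => exact fun _ _ => Submodule.mem_top
  | succ n ih =>
    refine Submodule.map₂_le.2 fun a ha b hb => ?_
    rw [Submodule.mem_comap, h]
    refine Submodule.apply_mem_map₂ _ ?_ (ih hb)
    rw [LinearMap.mem_ker] at ha ⊢
    rw [← LinearMap.comp_apply, hψ, ha]

theorem augmentation_comp_lmapDomain {x y : X} {x' y' : Y}
    (g : Path.Homotopic.Quotient x y → Path.Homotopic.Quotient x' y') :
    (augmentation x' y').comp (Finsupp.lmapDomain ℚ ℚ g) = augmentation x y := by
  ext p
  simp [augmentation, Finsupp.mapDomain_single]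

theorem lmapDomain_concat {x y : X} {x' y' : Y}
    (g : Path.Homotopic.Quotient x x → Path.Homotopic.Quotient x' x')
    (k : Path.Homotopic.Quotient x y → Path.Homotopic.Quotient x' y')
    (h : ∀ p q, k (p.trans q) = (g p).trans (k q)) (a : QPi x x) (b : QPi x y) :
    Finsupp.lmapDomain ℚ ℚ k (concat x x y a b) =
      concat x' x' y' (Finsupp.lmapDomain ℚ ℚ g a) (Finsupp.lmapDomain ℚ ℚ k b) := by
  induction a using Finsupp.induction_linear with
  | zero => simp
  | add a₁ a₂ h₁ h₂ => simp only [map_add, LinearMap.add_apply, h₁, h₂]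
  | single p c =>
    induction b using Finsupp.induction_linear with
    | zero => simp
    | add b₁ b₂ h₁ h₂ => simp only [map_add, h₁, h₂]
    | single q d =>
      simp only [concat_single, Finsupp.lmapDomain_apply, Finsupp.mapDomain_single, h]

/-- The map of completions `f_*` induced by a continuous map `f`, `[γ] ↦ [f ∘ γ]`. -/
def inducedMap (f : C(X, Y)) (x y : X) : Completion x y →ₗ[ℚ] Completion (f x) (f y) :=
  completionMap (Finsupp.lmapDomain ℚ ℚ fun γ => γ.map f)
    (filtration_le_comap (Finsupp.lmapDomain ℚ ℚ fun γ => γ.map f) _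
      (augmentation_comp_lmapDomain _)
      (lmapDomain_concat _ _ fun p q => by
        induction p using Path.Homotopic.Quotient.ind with | mk p =>
        induction q using Path.Homotopic.Quotient.ind with | mk q =>
        exact congrArg Path.Homotopic.Quotient.mk (p.map_trans q f.continuous)))

/-- The map of completions induced by the change of base points `γ ↦ p⁻¹ γ q`, for paths `p` from
`x` to `x'` and `q` from `y` to `y'`. -/
def changeBase {x y x' y' : X} (p : Path x x') (q : Path y y') :
    Completion x y →ₗ[ℚ] Completion x' y' :=
  completionMap
    (Finsupp.lmapDomain ℚ ℚ fun γ : Path.Homotopic.Quotient x y =>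
      ((Path.Homotopic.Quotient.mk p.symm).trans γ).trans (Path.Homotopic.Quotient.mk q))
    (filtration_le_comap
      (Finsupp.lmapDomain ℚ ℚ fun γ : Path.Homotopic.Quotient x x =>
        ((Path.Homotopic.Quotient.mk p.symm).trans γ).trans (Path.Homotopic.Quotient.mk p)) _
      (augmentation_comp_lmapDomain _)
      (lmapDomain_concat _ _ fun a b => by
        simp only [Path.Homotopic.Quotient.trans_assoc, Path.Homotopic.Quotient.mk_symm]
        rw [← Path.Homotopic.Quotient.trans_assoc (Path.Homotopic.Quotient.mk p),
          Path.Homotopic.Quotient.trans_symm, Path.Homotopic.Quotient.refl_trans]))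

end PathModule

/-! ### Manifolds -/

/-- A smooth `n`-manifold with boundary (`n ≥ 2`) is orientable if it is covered by charts, taken
from its maximal smooth atlas, whose transition maps have positive Jacobian determinant. -/
def IsOrientable (n : ℕ) [NeZero n] (M : Type*) [TopologicalSpace M]
    [ChartedSpace (EuclideanHalfSpace n) M] : Prop :=
  ∃ A ⊆ IsManifold.maximalAtlas (𝓡∂ n) ∞ M,
    (∀ x : M, ∃ e ∈ A, x ∈ e.source) ∧
    ∀ e ∈ A, ∀ e' ∈ A, ∀ x ∈ e.source ∩ e'.source,
      0 < (fderivWithin ℝ (e'.extend (𝓡∂ n) ∘ (e.extend (𝓡∂ n)).symm) (Set.range (𝓡∂ n))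
        (e.extend (𝓡∂ n) x)).det

section Cobordism

variable (S M : Type u) [TopologicalSpace S] [ChartedSpace (EuclideanHalfSpace 2) S]
  [TopologicalSpace M] [ChartedSpace (EuclideanHalfSpace 3) M]

/-- The boundary `∂Σ` of a surface. -/
abbrev SurfaceBoundary : Set S := (𝓡∂ 2).boundary S

/-- The boundary `∂(Σ × I)`, that is `Σ × {0, 1} ∪ ∂Σ × I`. -/
abbrev CylinderBoundary : Set (S × I) := ((𝓡∂ 2).prod (𝓡∂ 1)).boundary (S × I)

/-- The boundary `∂M` of a 3-manifold. -/
abbrev ThreeManifoldBoundary : Set M := (𝓡∂ 3).boundary M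

variable {S}

theorem mem_cylinderBoundary (p : S) (t : I) :
    (p, t) ∈ CylinderBoundary S ↔ p ∈ SurfaceBoundary S ∨ t = 0 ∨ t = 1 := by
  have h : (𝓡∂ 1).boundary I = {⊥, ⊤} := boundary_Icc
  rw [CylinderBoundary, ModelWithCorners.boundary_prod, Set.mem_union]
  change (p ∈ Set.univ ∧ t ∈ (𝓡∂ 1).boundary I) ∨ (p ∈ (𝓡∂ 2).boundary S ∧ t ∈ Set.univ) ↔ _
  rw [h]
  simp only [Set.mem_univ, true_and, and_true, Set.mem_insert_iff, Set.mem_singleton_iff]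
  exact or_comm

/-- The embedding `Σ → ∂(Σ × I)`, `p ↦ (p, 0)`. -/
def bottom : C(S, CylinderBoundary S) where
  toFun p := ⟨(p, 0), (mem_cylinderBoundary p 0).2 (Or.inr (Or.inl rfl))⟩
  continuous_toFun := by fun_prop

/-- The embedding `Σ → ∂(Σ × I)`, `p ↦ (p, 1)`. -/
def top : C(S, CylinderBoundary S) where
  toFun p := ⟨(p, 1), (mem_cylinderBoundary p 1).2 (Or.inr (Or.inr rfl))⟩
  continuous_toFun := by fun_prop

/-- The path `t ↦ (s, t)` in `∂(Σ × I)`, for `s ∈ ∂Σ`. -/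
def verticalPath (s : SurfaceBoundary S) : Path (bottom (s : S)) (top (s : S)) where
  toFun t := ⟨((s : S), t), (mem_cylinderBoundary (s : S) t).2 (Or.inl s.2)⟩
  continuous_toFun := by fun_prop
  source' := rfl
  target' := rfl

/-- The inclusion `ι : ∂(Σ × I) → Σ × I`. -/
def inclusion : C(CylinderBoundary S, S × I) where
  toFun := Subtype.val
  continuous_toFun := continuous_subtype_val

variable {M}

/-- A homeomorphism `∂(Σ × I) ≃ ∂M` as a map `α : ∂(Σ × I) → M`. -/
def boundaryMap (α : CylinderBoundary S ≃ₜ ThreeManifoldBoundary M) :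
    C(CylinderBoundary S, M) where
  toFun z := (α z : M)
  continuous_toFun := continuous_subtype_val.comp α.continuous

/-- `α₀ : Σ → M`, `p ↦ α(p, 0)`. -/
def bottomMap (α : CylinderBoundary S ≃ₜ ThreeManifoldBoundary M) : C(S, M) :=
  (boundaryMap α).comp bottom

/-- `α₁ : Σ → M`, `p ↦ α(p, 1)`. -/
def topMap (α : CylinderBoundary S ≃ₜ ThreeManifoldBoundary M) : C(S, M) :=
  (boundaryMap α).comp top

/-- `(M, α)` is a homology cobordism of `Σ`: the maps `α₀` and `α₁` induce isomorphisms
`H₁(Σ; ℤ) → H₁(M; ℤ)`. (Compactness, connectedness and orientability are assumed separately.) -/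
def IsHomologyCobordism (α : CylinderBoundary S ≃ₜ ThreeManifoldBoundary M) : Prop :=
  Function.Bijective (H1map (bottomMap α)) ∧ Function.Bijective (H1map (topMap α))

/-- The path `γ₀₁`, `t ↦ α(s, t)`, in `M`, for `s ∈ ∂Σ`. -/
def gamma (α : CylinderBoundary S ≃ₜ ThreeManifoldBoundary M) (s : SurfaceBoundary S) :
    Path (bottomMap α (s : S)) (topMap α (s : S)) :=
  (verticalPath s).map (boundaryMap α).continuous

/-- The action `(M, α)_* = α₁_*⁻¹ ∘ ⋄ ∘ α₀_*` on the completion of `ℚπ₁(Σ, s₁, s₂)`, where `⋄` is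
induced by `γ ↦ γ₁₀ γ γ₀₁`. For a homology cobordism `α₁_*` is bijective on the completions (by
Stallings' theorem), and then `Function.invFun` is its inverse. -/
def action (α : CylinderBoundary S ≃ₜ ThreeManifoldBoundary M) (s₁ s₂ : SurfaceBoundary S) :
    Completion (s₁ : S) (s₂ : S) → Completion (s₁ : S) (s₂ : S) := fun v =>
  Function.invFun (inducedMap (topMap α) (s₁ : S) (s₂ : S))
    (changeBase (gamma α s₁) (gamma α s₂) (inducedMap (bottomMap α) (s₁ : S) (s₂ : S) v))

end Cobordism

end HomologyCobordism

end

/-!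
# The kernel condition and the action of a homology cobordism modulo `F²`

The classes of paths in `M` are compared in the group `C₁(M) / B₁(M)` of one-chains modulo
boundaries, `PathGroup M`. Homomorphisms on it are the additive and homotopy invariant functions of
paths, and on `ℚπ₁(M, x, y)` affine functions of the class of a path are the same as linear maps
that vanish on `F²` (`exists_linearMap_of_pathGroup`, `exists_pathGroup_of_linearMap`). Both
conditions are equivalent to a third one: for each path `γ` in `Σ` that joins boundary points,
`γ₁₀ α₀(γ) γ₀₁` and `α₁(γ)` have the same class in `C₁(M) / B₁(M)`; in other words, `α` maps the
boundary of the rectangle `γ × I` to zero.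

For the kernels (`ker_eq_ker_iff`): the boundary of a rectangle is a class in the kernel of `ι_*`.
Conversely, `∂(Σ × I)` deforms to the bottom away from the top, and to the top away from the bottom,
so that each class in its `H₁` agrees, modulo boundaries of rectangles, with its projection to the
bottom (`H1ι_eq_of_rectangle_eq_zero`). As `α₀` and the inclusion of the bottom in `Σ × I` are
injective on `H₁`, both kernels are then the kernel of the projection to `Σ`.

For the action (`action_sub_mem_iff`): only the surjective part of Stallings' theorem is needed. The
quotients `Fⁿ / Fⁿ⁺¹` are generated by the quotient in degree one, hence a map that is surjective on
`H₁` is surjective on completions (`inducedMap_surjective`); a map that is injective on `H₁` is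
injective on `ℚπ₁ / F²` (`comap_filtration_two_le`), because homomorphisms to rational vector spaces
extend. So the action is congruent to the identity if and only if `γ₁₀ α₀(γ) γ₀₁` and `α₁(γ)` agree
modulo `F²` for all `γ`. Equality in `C₁(M) / B₁(M)` implies this.

The converse loses no torsion because `H₁(Σ)`, and with it `H₁(M)`, is separated by homomorphisms to
`ℝ` (`exists_H1_real_apply_ne_zero`). This replaces the computation of `H₁(Σ)` by the following
argument. A character `H₁(Σ) → ℝ / 2πℤ` extends to paths and defines a flat line bundle on `Σ`. By
Sard's theorem it has a section with finitely many zeros (`exists_finite_zeros_twistedSum`). Away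
from the zeros the argument of the section makes the character locally the increment of a real
function, so that it lifts to `ℝ` (`IsLocallyExact.exists_lift`). Since `Σ` is connected with
nonempty boundary, it can be pushed off the zeros by a map that is homotopic to the identity
(`exists_isIsotopic_disjoint`), along which the lift is pulled back to `Σ`.
-/

universe w

noncomputable section

namespace HomologyCobordism

/-! ### Singular chains -/

section

open CategoryTheory AlgebraicTopology

section Chains

section Quotients

variable {R : Type*} [Ring R]

theorem exists_linearMap_of_ker_le {M P A : Type*} [AddCommGroup M] [AddCommGroup P]
    [AddCommGroup A] [Module R M] [Module R P] [Module R A] {p : M →ₗ[R] P}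
    (hp : Function.Surjective p) {f : M →ₗ[R] A} (h : LinearMap.ker p ≤ LinearMap.ker f) :
    ∃ g : P →ₗ[R] A, ∀ x, g (p x) = f x := by
  refine ⟨((LinearMap.ker p).liftQ f h).comp
    (p.quotKerEquivOfSurjective hp).symm.toLinearMap, fun x => ?_⟩
  have : (p.quotKerEquivOfSurjective hp).symm (p x) = Submodule.Quotient.mk x := by
    rw [LinearEquiv.symm_apply_eq]; rfl
  rw [LinearMap.comp_apply, LinearEquiv.coe_coe, this, Submodule.liftQ_apply]

theorem exists_moduleCat_hom_ker_eq {M : ModuleCat.{u} R} (N : Submodule R M) :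
    ∃ (Q : ModuleCat.{u} R) (π : M ⟶ Q), LinearMap.ker π.hom = N :=
  ⟨ModuleCat.of R (M ⧸ N), ModuleCat.ofHom N.mkQ, N.ker_mkQ⟩

end Quotients

/-- The singular chain complex of `X` with coefficients in `ℤ` (lifted to the universe of `X`). -/
def chains (X : Type u) [TopologicalSpace X] : ChainComplex (ModuleCat.{u} ℤ) ℕ :=
  ((singularChainComplexFunctor (ModuleCat.{u} ℤ)).obj
    (ModuleCat.of ℤ (ULift.{u} ℤ))).obj (TopCat.of X)

variable {X Y : Type u} [TopologicalSpace X] [TopologicalSpace Y]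

/-- The chain map induced by a continuous map. -/
def chainsMap (f : C(X, Y)) : chains X ⟶ chains Y :=
  ((singularChainComplexFunctor (ModuleCat.{u} ℤ)).obj
    (ModuleCat.of ℤ (ULift.{u} ℤ))).map (TopCat.ofHom f)

/-- The singular chain given by one singular simplex. -/
def simplexChain {n : ℕ} (s : C(stdSimplex ℝ (Fin (n + 1)), X)) : (chains X).X n :=
  (SSet.ιChainComplex (R := ModuleCat.of ℤ (ULift.{u} ℤ)) (TopCat.toSSet.obj (TopCat.of X))
    (((TopCat.of X).toSSetObjEquiv (.op (SimplexCategory.mk n))).symm s)).hom (ULift.up 1)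

/-- The `i`-th face inclusion of standard simplices. -/
def faceMap {n : ℕ} (i : Fin (n + 2)) :
    C(stdSimplex ℝ (Fin (n + 1)), stdSimplex ℝ (Fin (n + 2))) :=
  ⟨stdSimplex.map i.succAbove, stdSimplex.continuous_map _⟩

theorem d_simplexChain {n : ℕ} (s : C(stdSimplex ℝ (Fin (n + 2)), X)) :
    (chains X).d (n + 1) n (simplexChain s) =
      ∑ i : Fin (n + 2), (-1 : ℤ) ^ i.val • simplexChain (s.comp (faceMap i)) := by
  have := congrArg (fun f => f.hom (ULift.up 1)) (SSet.ιChainComplex_d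
    (R := ModuleCat.of ℤ (ULift.{u} ℤ)) (X := TopCat.toSSet.obj (TopCat.of X))
    (((TopCat.of X).toSSetObjEquiv (.op (SimplexCategory.mk (n+1)))).symm s))
  simp only [ModuleCat.hom_comp, LinearMap.comp_apply] at this
  refine this.trans ?_
  rw [ModuleCat.hom_sum, LinearMap.sum_apply]
  rfl

theorem chainsMap_simplexChain {n : ℕ} (f : C(X, Y)) (s : C(stdSimplex ℝ (Fin (n + 1)), X)) :
    (chainsMap f).f n (simplexChain s) = simplexChain (f.comp s) := by
  have := congrArg (fun f => f.hom (ULift.up 1)) (SSet.ι_chainComplexMap_f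
    (TopCat.toSSet.obj (TopCat.of X)) (TopCat.toSSet.obj (TopCat.of Y))
    (TopCat.toSSet.map (TopCat.ofHom f)) (ModuleCat.of ℤ (ULift.{u} ℤ))
    (((TopCat.of X).toSSetObjEquiv (.op (SimplexCategory.mk n))).symm s))
  exact this

/-- The case of `exists_chains_lift` in which the values lie in the universe of `X`, from the universal
property in the category of modules. As `H₁` is a module by its place in that category, the module
structure of `A` over `ℤ` is arbitrary. -/
theorem exists_chains_lift_aux {n : ℕ} {A : Type u} [AddCommGroup A] [hA : Module ℤ A]
    (φ : C(stdSimplex ℝ (Fin (n + 1)), X) → A) :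
    ∃ f : (chains X).X n →ₗ[ℤ] A, ∀ s, f (simplexChain s) = φ s := by
  let e := ((TopCat.of X).toSSetObjEquiv (.op (SimplexCategory.mk n)))
  let K := TopCat.toSSet.obj (TopCat.of X)
  let g : (chains X).X n ⟶ ModuleCat.of ℤ A :=
    (SSet.isColimitChainComplexXCofan K (ModuleCat.of ℤ (ULift.{u} ℤ)) n).desc
      (Limits.Cofan.mk (ModuleCat.of ℤ A) fun s =>
        ModuleCat.ofHom ((LinearMap.toSpanSingleton ℤ A (φ (e s))).comp
          (ULift.moduleEquiv.toLinearMap)))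
  refine ⟨g.hom, fun s => ?_⟩
  have := (SSet.isColimitChainComplexXCofan K (ModuleCat.of ℤ (ULift.{u} ℤ)) n).fac
      (Limits.Cofan.mk (ModuleCat.of ℤ A) fun s =>
        ModuleCat.ofHom ((LinearMap.toSpanSingleton ℤ A (φ (e s))).comp
          (ULift.moduleEquiv.toLinearMap))) ⟨e.symm s⟩
  have := congrArg (fun f => f.hom (ULift.up 1)) this
  refine Eq.trans ?_ (this.trans ?_)
  · rfl
  · simp [e]
    exact hA.toMulAction.one_smul _

theorem chains_hom_ext {n : ℕ} {A : Type u} [AddCommGroup A] [hA : Module ℤ A]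
    {f g : (chains X).X n →ₗ[ℤ] A}
    (h : ∀ s, f (simplexChain s) = g (simplexChain s)) : f = g := by
  let e := ((TopCat.of X).toSSetObjEquiv (.op (SimplexCategory.mk n)))
  have : ModuleCat.ofHom (X := (chains X).X n) (Y := A) f = ModuleCat.ofHom g := by
    refine SSet.chainComplex_hom_ext (R := ModuleCat.of ℤ (ULift.{u} ℤ))
      (X := TopCat.toSSet.obj (TopCat.of X)) fun s => ?_
    apply ModuleCat.hom_ext
    let i : ULift.{u} ℤ →ₗ[ℤ] (chains X).X n :=
      (SSet.ιChainComplex (R := ModuleCat.of ℤ (ULift.{u} ℤ)) (TopCat.toSSet.obj (TopCat.of X))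
        s).hom
    change f.comp i = g.comp i
    have h1 : f (i (ULift.up 1)) = g (i (ULift.up 1)) := by
      have := h (e s)
      simp only [simplexChain, e] at this
      rwa [Equiv.symm_apply_apply] at this
    apply LinearMap.ext
    rintro ⟨m⟩
    have hm : (ULift.up m : ULift.{u} ℤ) = m • ULift.up 1 := by ext; simp
    have h2 : ∀ k : ULift.{u} ℤ →ₗ[ℤ] A, k (ULift.up m) = m • k (ULift.up 1) := fun k => by
      rw [hm]; exact map_zsmul k.toAddMonoidHom m _
    rw [h2, h2, LinearMap.comp_apply, LinearMap.comp_apply, h1]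
  exact congrArg (fun f => f.hom) this

/-- The singular chains given by the singular simplices generate the group of chains. -/
theorem span_simplexChain (n : ℕ) :
    Submodule.span ℤ
      (Set.range fun s : C(stdSimplex ℝ (Fin (n + 1)), X) => simplexChain s) = ⊤ := by
  obtain ⟨Q, π, hπ⟩ := exists_moduleCat_hom_ker_eq (M := (chains X).X n) (Submodule.span ℤ
    (Set.range fun s : C(stdSimplex ℝ (Fin (n + 1)), X) => simplexChain s))
  rw [← hπ, LinearMap.ker_eq_top]
  refine chains_hom_ext fun s => ?_
  rw [LinearMap.zero_apply, ← LinearMap.mem_ker, hπ]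
  exact Submodule.subset_span ⟨s, rfl⟩

/-- A function on singular simplices, with values in any abelian group, extends to chains. -/
theorem exists_chains_lift {n : ℕ} {A : Type w} [AddCommGroup A] [hA : Module ℤ A]
    (φ : C(stdSimplex ℝ (Fin (n + 1)), X) → A) :
    ∃ f : (chains X).X n →ₗ[ℤ] A, ∀ s, f (simplexChain s) = φ s := by
  obtain ⟨f, hf⟩ := exists_chains_lift_aux
    (fun s : C(stdSimplex ℝ (Fin (n + 1)), X) => Finsupp.single s (1 : ℤ))
  exact ⟨(Finsupp.linearCombination ℤ φ).comp f, fun s => by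
    simp [hf]
    exact hA.toMulAction.one_smul _⟩

end Chains

section PathGroup

/-- The group `C₁(X) / B₁(X)` of singular one-chains modulo boundaries. It contains `H₁(X)` and the
classes of paths which are not closed; a homomorphism on it is the same as a function on paths that
is additive under concatenation and invariant under homotopy. -/
def PathGroup (X : Type u) [TopologicalSpace X] : ModuleCat.{u} ℤ := (chains X).opcycles 1

variable {X Y : Type u} [TopologicalSpace X] [TopologicalSpace Y]

/-- The projection of one-chains to `C₁(X) / B₁(X)`. -/
def toPathGroup : (chains X).X 1 →ₗ[ℤ] PathGroup X := ((chains X).pOpcycles 1).hom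

theorem toPathGroup_surjective : Function.Surjective (toPathGroup (X := X)) :=
  (ModuleCat.epi_iff_surjective ((chains X).pOpcycles 1)).1 inferInstance

theorem toPathGroup_d (c : (chains X).X 2) : toPathGroup ((chains X).d 2 1 c) = 0 := by
  have := congrArg (fun f => f.hom c) ((chains X).d_pOpcycles 2 1)
  exact this

/-- The universal property of `C₁(X) / B₁(X)`. -/
theorem exists_pathGroup_lift_of_chains {A : Type w} [AddCommGroup A] [hA : Module ℤ A]
    (f : (chains X).X 1 →ₗ[ℤ] A)
    (hf : ∀ c, f ((chains X).d 2 1 c) = 0) :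
    ∃ g : PathGroup X →ₗ[ℤ] A, ∀ c, g (toPathGroup c) = f c := by
  have hker : LinearMap.ker (toPathGroup (X := X)) ≤ LinearMap.ker f := by
    intro c hc
    obtain ⟨Q, π, hN⟩ := exists_moduleCat_hom_ker_eq (LinearMap.range ((chains X).d 2 1).hom)
    have hπ : (chains X).d 2 1 ≫ π = 0 := by
      apply ModuleCat.hom_ext
      refine LinearMap.ext fun x => ?_
      rw [ModuleCat.hom_comp, LinearMap.comp_apply]
      exact LinearMap.mem_ker.1 (hN ▸ LinearMap.mem_range_self _ x)
    have h1 : ((chains X).descOpcycles π 2 (by simp) hπ).hom (toPathGroup c) = π.hom c :=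
      congrArg (fun f => f.hom c) ((chains X).p_descOpcycles π 2 (by simp) hπ)
    have h1 : π.hom c = 0 := by
      rw [← h1, LinearMap.mem_ker.1 hc]
      exact map_zero ((chains X).descOpcycles π 2 (by simp) hπ).hom
    obtain ⟨b, rfl⟩ : c ∈ LinearMap.range ((chains X).d 2 1).hom := by
      rw [← hN]; exact LinearMap.mem_ker.2 h1
    exact hf b
  exact exists_linearMap_of_ker_le toPathGroup_surjective hker

end PathGroup

end

/-! ### Classes of paths -/

section

open CategoryTheory AlgebraicTopology

section PathGroup

variable {X Y : Type u} [TopologicalSpace X] [TopologicalSpace Y]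

/-- The singular one-simplex given by a path. -/
def pathSimplex {x y : X} (p : Path x y) : C(stdSimplex ℝ (Fin (1 + 1)), X) :=
  ⟨fun s => p (stdSimplexHomeomorphUnitInterval s), by fun_prop⟩

/-- The path given by a singular one-simplex. -/
def simplexPath (s : C(stdSimplex ℝ (Fin (1 + 1)), X)) :
    Path (s (stdSimplex.vertex 0)) (s (stdSimplex.vertex 1)) where
  toFun t := s (stdSimplexHomeomorphUnitInterval.symm t)
  continuous_toFun := by fun_prop
  source' := by
    congr 1
    rw [Homeomorph.symm_apply_eq]
    exact stdSimplexHomeomorphUnitInterval_zero.symm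
  target' := by
    congr 1
    rw [Homeomorph.symm_apply_eq]
    exact stdSimplexHomeomorphUnitInterval_one.symm

theorem pathSimplex_simplexPath (s : C(stdSimplex ℝ (Fin (1 + 1)), X)) :
    pathSimplex (simplexPath s) = s := by
  ext a
  exact congrArg s (stdSimplexHomeomorphUnitInterval.symm_apply_apply a)

/-- The class in `C₁(X) / B₁(X)` of a path. -/
def pathClass {x y : X} (p : Path x y) : PathGroup X := toPathGroup (simplexChain (pathSimplex p))

theorem pathClass_congr {x y x' y' : X} {p : Path x y} {q : Path x' y'}
    (h : (p : I → X) = q) : pathClass p = pathClass q := by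
  have : pathSimplex p = pathSimplex q := by
    ext a
    exact congrFun h _
  rw [pathClass, this, pathClass]

theorem d_simplexChain_two (t : C(stdSimplex ℝ (Fin (1 + 2)), X)) :
    (chains X).d 2 1 (simplexChain t) = simplexChain (t.comp (faceMap 0)) -
      simplexChain (t.comp (faceMap 1)) + simplexChain (t.comp (faceMap 2)) := by
  refine (d_simplexChain t).trans ?_
  change ∑ i : Fin 3, _ = _
  rw [Fin.sum_univ_three]
  change (1 : ℤ) • _ + (-1 : ℤ) • _ + (-1 : ℤ) ^ 2 • _ = _
  simp [sub_eq_add_neg]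

theorem faceMap_apply (i : Fin 3) (s : stdSimplex ℝ (Fin (1 + 1))) (j : Fin 3) :
    (faceMap (n := 1) i s : Fin 3 → ℝ) j =
      (if i.succAbove 0 = j then s 0 else 0) + (if i.succAbove 1 = j then s 1 else 0) := by
  simp only [faceMap, ContinuousMap.coe_mk, stdSimplex.map_coe, FunOnFinite.linearMap_apply_apply]
  rw [Finset.sum_filter]
  exact Fin.sum_univ_two _

/-- The barycentric coordinates of a point of the triangle, as elements of the unit interval. -/
def triangleCoord (s : stdSimplex ℝ (Fin (1 + 2))) (i : Fin 3) : I :=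
  ⟨s i, stdSimplex.zero_le s i, stdSimplex.le_one s i⟩

theorem continuous_triangleCoord (i : Fin 3) : Continuous fun s => triangleCoord s i :=
  Continuous.subtype_mk ((continuous_apply i).comp continuous_subtype_val) _

theorem sum_triangleCoord (s : stdSimplex ℝ (Fin (1 + 2))) :
    (triangleCoord s 0 : ℝ) + triangleCoord s 1 + triangleCoord s 2 = 1 :=
  (Fin.sum_univ_three (fun i : Fin 3 => s i)).symm.trans (stdSimplex.sum_eq_one s)

/-- The boundary relation of a singular triangle `t` with edges `p`, `q` and `r`. -/
theorem pathClass_triangle (t : C(stdSimplex ℝ (Fin (1 + 2)), X)) {x₀ x₁ x₂ : X}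
    (p : Path x₀ x₁) (q : Path x₁ x₂) (r : Path x₀ x₂)
    (hp : ∀ s : stdSimplex ℝ (Fin (1 + 2)), triangleCoord s 2 = 0 → t s = p (triangleCoord s 1))
    (hq : ∀ s : stdSimplex ℝ (Fin (1 + 2)), triangleCoord s 0 = 0 → t s = q (triangleCoord s 2))
    (hr : ∀ s : stdSimplex ℝ (Fin (1 + 2)), triangleCoord s 1 = 0 → t s = r (triangleCoord s 2)) :
    pathClass r = pathClass p + pathClass q := by
  have h := toPathGroup_d (simplexChain t)
  have h0 : t.comp (faceMap 0) = pathSimplex q := by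
    ext s
    refine (hq _ (Subtype.ext ?_)).trans (congrArg q (Subtype.ext ?_))
    · exact (faceMap_apply 0 s 0).trans (by simp [Fin.succAbove])
    · exact (faceMap_apply 0 s 2).trans (by simp [Fin.succAbove, Fin.ext_iff]; rfl)
  have h1 : t.comp (faceMap 1) = pathSimplex r := by
    ext s
    refine (hr _ (Subtype.ext ?_)).trans (congrArg r (Subtype.ext ?_))
    · exact (faceMap_apply 1 s 1).trans (by simp [Fin.succAbove])
    · exact (faceMap_apply 1 s 2).trans (by simp [Fin.succAbove, Fin.ext_iff]; rfl)
  have h2 : t.comp (faceMap 2) = pathSimplex p := by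
    ext s
    refine (hp _ (Subtype.ext ?_)).trans (congrArg p (Subtype.ext ?_))
    · exact (faceMap_apply 2 s 2).trans (by simp [Fin.succAbove])
    · exact (faceMap_apply 2 s 1).trans (by simp [Fin.succAbove]; rfl)
  rw [d_simplexChain_two, h0, h1, h2, map_add, map_sub] at h
  change pathClass q - pathClass r + pathClass p = 0 at h
  rw [sub_add_eq_add_sub, sub_eq_zero] at h
  rw [← h, add_comm]

/-- The triangle with edges `p`, `q` and `p.trans q` is mapped to `X` through its projection to the
long edge. -/
theorem pathClass_trans {x y z : X} (p : Path x y) (q : Path y z) :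
    pathClass (p.trans q) = pathClass p + pathClass q := by
  have h0 : ∀ s i, (0 : ℝ) ≤ triangleCoord s i := fun s i => (triangleCoord s i).2.1
  let m : stdSimplex ℝ (Fin (1 + 2)) → I := fun s =>
    ⟨triangleCoord s 1 / 2 + triangleCoord s 2, by
      have := h0 s 0; have := h0 s 1; have := h0 s 2; have := sum_triangleCoord s
      constructor <;> linarith⟩
  have hm : Continuous m := Continuous.subtype_mk
    (((continuous_subtype_val.comp (continuous_triangleCoord 1)).div_const 2).add
      (continuous_subtype_val.comp (continuous_triangleCoord 2))) _
  let t : C(stdSimplex ℝ (Fin (1 + 2)), X) := ⟨fun s => (p.trans q) (m s), by fun_prop⟩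
  have hp : ∀ a b : I, (a : ℝ) = b / 2 → (p.trans q) a = p b := fun a b h => by
    rw [Path.trans_apply, dif_pos (by have := b.2.2; linarith)]
    congr 1
    ext
    simp only
    linarith
  have hq : ∀ a b : I, (a : ℝ) = 1 / 2 + b / 2 → (p.trans q) a = q b := fun a b h => by
    rcases eq_or_ne b 0 with rfl | hb
    · rw [hp a 1 (by simpa using h), p.target, q.source]
    · have : (0 : ℝ) < b := lt_of_le_of_ne b.2.1 fun h => hb (Subtype.ext h.symm)
      rw [Path.trans_apply, dif_neg (by linarith)]
      congr 1
      ext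
      simp only
      linarith
  refine pathClass_triangle t p q (p.trans q) (fun s hs => hp _ _ ?_) (fun s hs => hq _ _ ?_)
    (fun s hs => congrArg (p.trans q) (Subtype.ext ?_))
  all_goals
    have := sum_triangleCoord s
    simp only [m, hs, Set.Icc.coe_zero] at this ⊢
    linarith

theorem pathClass_refl (x : X) : pathClass (Path.refl x) = 0 := by
  have := pathClass_trans (Path.refl x) (Path.refl x)
  rwa [Path.refl_trans_refl, left_eq_add] at this

/-- A homotopy relative to the endpoints is a square, which is the sum of two triangles. -/
theorem pathClass_eq_of_homotopic {x y : X} {p q : Path x y} (h : p.Homotopic q) :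
    pathClass p = pathClass q := by
  obtain ⟨H⟩ := h
  have h0 : ∀ s i, (0 : ℝ) ≤ triangleCoord s i := fun s i => (triangleCoord s i).2.1
  let m : stdSimplex ℝ (Fin (1 + 2)) → I := fun s =>
    ⟨triangleCoord s 1 + triangleCoord s 2, by
      have := h0 s 0; have := h0 s 1; have := h0 s 2; have := sum_triangleCoord s
      constructor <;> linarith⟩
  have hm : Continuous m := Continuous.subtype_mk
    ((continuous_subtype_val.comp (continuous_triangleCoord 1)).add
      (continuous_subtype_val.comp (continuous_triangleCoord 2))) _
  have hc := continuous_triangleCoord 2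
  have m0 : ∀ s, triangleCoord s 0 = 0 → m s = 1 := fun s hs => by
    have := sum_triangleCoord s
    ext
    simp only [m, hs, Set.Icc.coe_zero, Set.Icc.coe_one] at this ⊢
    linarith
  have m1 : ∀ s, triangleCoord s 1 = 0 → m s = triangleCoord s 2 := fun s hs => by
    ext; simp [m, hs]
  have m2 : ∀ s, triangleCoord s 2 = 0 → m s = triangleCoord s 1 := fun s hs => by
    ext; simp [m, hs]
  -- The square is cut along its diagonal `d`; two of the five edges are constant.
  let d : Path x y := ⟨⟨fun a => H (a, a), by fun_prop⟩, by simp, by simp⟩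
  let t₁ : C(stdSimplex ℝ (Fin (1 + 2)), X) := ⟨fun s => H (triangleCoord s 2, m s), by fun_prop⟩
  let t₂ : C(stdSimplex ℝ (Fin (1 + 2)), X) := ⟨fun s => H (m s, triangleCoord s 2), by fun_prop⟩
  have e₁ : pathClass d = pathClass p + pathClass (Path.refl y) := by
    refine pathClass_triangle t₁ p _ d (fun s hs => ?_) (fun s hs => ?_) (fun s hs => ?_)
    · change H _ = _
      rw [hs, m2 s hs, H.apply_zero]; rfl
    · change H _ = _
      rw [m0 s hs, H.target, Path.refl_apply]
    · change H _ = H _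
      rw [m1 s hs]
  have e₂ : pathClass d = pathClass (Path.refl x) + pathClass q := by
    refine pathClass_triangle t₂ _ q d (fun s hs => ?_) (fun s hs => ?_) (fun s hs => ?_)
    · change H _ = _
      rw [hs, H.source, Path.refl_apply]
    · change H _ = _
      rw [m0 s hs, H.apply_one]; rfl
    · change H _ = H _
      rw [m1 s hs]
  rw [pathClass_refl, add_zero] at e₁
  rw [pathClass_refl, zero_add] at e₂
  exact e₁.symm.trans e₂

theorem pathClass_symm {x y : X} (p : Path x y) : pathClass p.symm = - pathClass p := by
  have h : pathClass (p.trans p.symm) = 0 := by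
    rw [pathClass_eq_of_homotopic ⟨(Path.Homotopy.reflTransSymm p).symm⟩, pathClass_refl]
  rw [pathClass_trans] at h
  exact (neg_eq_of_add_eq_zero_right h).symm

theorem span_pathClass : Submodule.span ℤ
    {c : PathGroup X | ∃ (x y : X) (p : Path x y), c = pathClass p} = ⊤ := by
  rw [eq_top_iff, ← LinearMap.range_eq_top.2 (toPathGroup_surjective (X := X)),
    ← Submodule.map_top, ← span_simplexChain, Submodule.map_span]
  refine Submodule.span_mono ?_
  rintro _ ⟨_, ⟨s, rfl⟩, rfl⟩
  refine ⟨_, _, simplexPath s, ?_⟩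
  rw [pathClass, pathSimplex_simplexPath]

/-- A function on paths that is additive under concatenation and invariant under homotopies
relative to the endpoints is a homomorphism on `C₁(X) / B₁(X)`. -/
theorem exists_pathGroup_lift {A : Type w} [AddCommGroup A] [hA : Module ℤ A]
    (ψ : ∀ x y : X, Path x y → A)
    (htrans : ∀ x y z (p : Path x y) (q : Path y z), ψ x z (p.trans q) = ψ x y p + ψ y z q)
    (hhom : ∀ x y (p q : Path x y), p.Homotopic q → ψ x y p = ψ x y q) :
    ∃ g : PathGroup X →ₗ[ℤ] A, ∀ (x y : X) (p : Path x y), g (pathClass p) = ψ x y p := by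
  obtain ⟨f, hf⟩ := exists_chains_lift (n := 1) (X := X) fun s => ψ _ _ (simplexPath s)
  have hcast : ∀ {x y x' y' : X} (p : Path x y) (q : Path x' y'), x = x' → y = y' →
      (p : I → X) = q → ψ x y p = ψ x' y' q := by
    rintro x y _ _ p q rfl rfl h
    congr 1
    exact Path.ext h
  have hd : ∀ c, f ((chains X).d 2 1 c) = 0 := by
    have : f.comp ((chains X).d 2 1).hom = 0 := by
      rw [← LinearMap.ker_eq_top, eq_top_iff, ← span_simplexChain, Submodule.span_le]
      rintro _ ⟨t, rfl⟩
      change f ((chains X).d 2 1 (simplexChain t)) = 0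
      rw [d_simplexChain_two, map_add, map_sub, hf, hf, hf]
      have hv : ∀ (i : Fin 3) (j : Fin 2), faceMap (n := 1) i (stdSimplex.vertex j) =
          stdSimplex.vertex (i.succAbove j) := fun i j => stdSimplex.map_vertex _ _
      let e : ∀ i : Fin 3, Path (stdSimplex.vertex (S := ℝ) (i.succAbove 0))
        (stdSimplex.vertex (S := ℝ) (i.succAbove 1)) := fun i =>
          (simplexPath (faceMap (n := 1) i)).cast (hv i 0).symm (hv i 1).symm
      have he : ∀ i, ψ _ _ (simplexPath (t.comp (faceMap i))) = ψ _ _ ((e i).map t.continuous) :=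
        fun i => hcast _ _ (congrArg t (hv i 0)) (congrArg t (hv i 1)) rfl
      rw [he, he, he]
      let e₂ : Path (stdSimplex.vertex (S := ℝ) (0 : Fin 3)) (stdSimplex.vertex (S := ℝ) 1) := e 2
      let e₀ : Path (stdSimplex.vertex (S := ℝ) (1 : Fin 3)) (stdSimplex.vertex (S := ℝ) 2) := e 0
      let e₁ : Path (stdSimplex.vertex (S := ℝ) (0 : Fin 3)) (stdSimplex.vertex (S := ℝ) 2) := e 1
      have : ContractibleSpace (stdSimplex ℝ (Fin 3)) :=
        (convex_stdSimplex ℝ (Fin 3)).contractibleSpace ⟨_, single_mem_stdSimplex ℝ 0⟩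
      have hh : (e₂.trans e₀).Homotopic e₁ := SimplyConnectedSpace.paths_homotopic _ _
      have h3 := hhom _ _ _ _ (hh.map t)
      change ψ _ _ ((e₂.trans e₀).map t.continuous) = _ at h3
      rw [Path.map_trans, htrans] at h3
      change ψ _ _ (e₀.map t.continuous) - ψ _ _ (e₁.map t.continuous) +
        ψ _ _ (e₂.map t.continuous) = 0
      change _ = ψ _ _ (e₁.map t.continuous) at h3
      rw [← h3]
      abel
    exact fun c => LinearMap.congr_fun this c
  obtain ⟨g, hg⟩ := exists_pathGroup_lift_of_chains f hd
  refine ⟨g, fun x y p => ?_⟩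
  rw [pathClass, hg, hf]
  refine hcast _ _ ?_ ?_ ?_
  · exact (congrArg p stdSimplexHomeomorphUnitInterval_zero).trans p.source
  · exact (congrArg p stdSimplexHomeomorphUnitInterval_one).trans p.target
  · ext t
    exact congrArg p (stdSimplexHomeomorphUnitInterval.apply_symm_apply t)

theorem pathGroup_hom_ext {A : Type w} [AddCommGroup A] [hA : Module ℤ A]
    {f g : PathGroup X →ₗ[ℤ] A}
    (h : ∀ (x y : X) (p : Path x y), f (pathClass p) = g (pathClass p)) : f = g := by
  refine LinearMap.ext_on span_pathClass ?_
  rintro _ ⟨x, y, p, rfl⟩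
  exact h x y p

end PathGroup

end

/-! ### First homology and classes of paths -/

section

open CategoryTheory AlgebraicTopology

section PathGroup

variable {X Y : Type u} [TopologicalSpace X] [TopologicalSpace Y]

/-- The inclusion of `H₁(X)` into `C₁(X) / B₁(X)`. -/
def H1ι (X : Type u) [TopologicalSpace X] : H1 X →ₗ[ℤ] PathGroup X :=
  ((chains X).homologyι 1).hom

theorem H1ι_injective : Function.Injective (H1ι X) :=
  (ModuleCat.mono_iff_injective ((chains X).homologyι 1)).1 inferInstance

/-- The boundary map `C₁(X) / B₁(X) → C₀(X)`. -/
def pathBoundary (X : Type u) [TopologicalSpace X] : PathGroup X →ₗ[ℤ] (chains X).X 0 :=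
  ((chains X).fromOpcycles 1 0).hom

/-- The zero-chain given by a point. -/
def pointChain (x : X) : (chains X).X 0 := simplexChain (n := 0) (ContinuousMap.const _ x)

theorem pathBoundary_toPathGroup (c : (chains X).X 1) :
    pathBoundary X (toPathGroup c) = (chains X).d 1 0 c :=
  congrArg (fun f => f.hom c) ((chains X).p_fromOpcycles 1 0)

theorem pathBoundary_pathClass {x y : X} (p : Path x y) :
    pathBoundary X (pathClass p) = pointChain y - pointChain x := by
  rw [pathClass, pathBoundary_toPathGroup]
  refine (d_simplexChain (n := 0) (pathSimplex p)).trans ?_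
  change ∑ i : Fin 2, _ = _
  rw [Fin.sum_univ_two]
  change (1 : ℤ) • _ + (-1 : ℤ) • _ = _
  have h : ∀ s : stdSimplex ℝ (Fin (0 + 1)), s = stdSimplex.vertex 0 := fun s => by
    subsingleton
  have h0 : (pathSimplex p).comp (faceMap (n := 0) 0) = ContinuousMap.const _ y := by
    ext s
    rw [h s]
    refine (congrArg (pathSimplex p) (stdSimplex.map_vertex _ _)).trans ?_
    exact (congrArg p stdSimplexHomeomorphUnitInterval_one).trans p.target
  have h1 : (pathSimplex p).comp (faceMap (n := 0) 1) = ContinuousMap.const _ x := by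
    ext s
    rw [h s]
    refine (congrArg (pathSimplex p) (stdSimplex.map_vertex _ _)).trans ?_
    exact (congrArg p stdSimplexHomeomorphUnitInterval_zero).trans p.source
  rw [h0, h1, one_smul, neg_one_zsmul, ← sub_eq_add_neg]
  rfl

theorem pathBoundary_H1ι (h : H1 X) : pathBoundary X (H1ι X h) = 0 :=
  congrArg (fun f => f.hom h) ((chains X).homologyι_comp_fromOpcycles 1 0)

theorem exists_H1ι_eq {c : PathGroup X} (hc : pathBoundary X c = 0) : ∃ h, H1ι X h = c := by
  let S := ShortComplex.mk _ _ ((chains X).homologyι_comp_fromOpcycles 1 0)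
  have hS : S.Exact := S.exact_of_f_is_kernel ((chains X).homologyIsKernel 1 0 (by simp))
  exact (ShortComplex.moduleCat_exact_iff S).1 hS c hc

theorem exists_H1ι_eq_pathClass {x : X} (p : Path x x) : ∃ h, H1ι X h = pathClass p :=
  exists_H1ι_eq (by rw [pathBoundary_pathClass, sub_self])

/-- A function on points extends to zero-chains. -/
theorem exists_pointChain_lift {A : Type w} [AddCommGroup A] [hA : Module ℤ A] (f : X → A) :
    ∃ g : (chains X).X 0 →ₗ[ℤ] A, ∀ x, g (pointChain x) = f x := by
  obtain ⟨g, hg⟩ := exists_chains_lift (n := 0) (X := X) fun s => f (s (stdSimplex.vertex 0))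
  exact ⟨g, fun x => hg _⟩

/-- If a homomorphism on `C₁(X) / B₁(X)` is the coboundary of a function, then it vanishes on
`H₁(X)`. -/
theorem eq_on_H1_of_coboundary {A : Type w} [AddCommGroup A] [hA : Module ℤ A]
    {g g' : PathGroup X →ₗ[ℤ] A} (f : X → A)
    (hg : ∀ (x y : X) (p : Path x y), g (pathClass p) = g' (pathClass p) + (f y - f x))
    (h : H1 X) : g (H1ι X h) = g' (H1ι X h) := by
  obtain ⟨k, hk⟩ := exists_pointChain_lift f
  have : g = g' + k.comp (pathBoundary X) := pathGroup_hom_ext fun x y p => by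
    rw [hg, LinearMap.add_apply, LinearMap.comp_apply, pathBoundary_pathClass, map_sub, hk, hk]
  rw [this, LinearMap.add_apply, LinearMap.comp_apply, pathBoundary_H1ι, map_zero, add_zero]

/-- The map of `C₁ / B₁` induced by a continuous map. -/
def pathGroupMap (f : C(X, Y)) : PathGroup X →ₗ[ℤ] PathGroup Y :=
  (HomologicalComplex.opcyclesMap (chainsMap f) 1).hom

theorem pathGroupMap_pathClass (f : C(X, Y)) {x y : X} (p : Path x y) :
    pathGroupMap f (pathClass p) = pathClass (p.map f.continuous) := by
  have h := congrArg (fun k => k.hom (simplexChain (pathSimplex p)))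
    (HomologicalComplex.p_opcyclesMap (chainsMap f) 1)
  refine h.trans ?_
  change toPathGroup ((chainsMap f).f 1 _) = _
  rw [chainsMap_simplexChain]
  rfl

theorem H1ι_H1map (f : C(X, Y)) (h : H1 X) : H1ι Y (H1map f h) = pathGroupMap f (H1ι X h) :=
  congrArg (fun k => k.hom h) (HomologicalComplex.homologyι_naturality (chainsMap f) 1)

theorem pathClass_map_add_evalAt {f g : C(X, Y)} (H : f.Homotopy g) {x y : X} (p : Path x y) :
    pathClass (p.map f.continuous) + pathClass (H.evalAt y) =
      pathClass (H.evalAt x) + pathClass (p.map g.continuous) := by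
  have := pathClass_eq_of_homotopic (Path.Homotopic.map_trans_evalAt H p)
  rwa [pathClass_trans, pathClass_trans] at this

/-- Homotopic maps induce the same map on `H₁`. -/
theorem pathGroupMap_H1ι_of_homotopic {f g : C(X, Y)} (hfg : f.Homotopic g) (h : H1 X) :
    pathGroupMap f (H1ι X h) = pathGroupMap g (H1ι X h) := by
  obtain ⟨H⟩ := hfg
  refine eq_on_H1_of_coboundary (fun x => - pathClass (H.evalAt x)) (fun x y p => ?_) h
  rw [pathGroupMap_pathClass, pathGroupMap_pathClass,
    eq_sub_of_add_eq (pathClass_map_add_evalAt H p)]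
  abel

end PathGroup

end

/-! ### Lifting homomorphisms from `ℝ / 2πℤ` to `ℝ` -/

section

open Topology

section Development

variable {X : Type u} [TopologicalSpace X]

/-- A real-valued function `L` on `K` is a development along `F : K → X` of a homomorphism `g` with
values in `ℝ / 2πℤ` if its increments along paths lift the values of `g` on the images of these
paths. -/
def IsDevelopment (g : PathGroup X →ₗ[ℤ] Real.Angle) {K : Type*} [TopologicalSpace K]
    (F : C(K, X)) (L : C(K, ℝ)) : Prop :=
  ∀ (k k' : K) (q : Path k k'), ((L k' - L k : ℝ) : Real.Angle) = g (pathClass (q.map F.continuous))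

variable {g : PathGroup X →ₗ[ℤ] Real.Angle} {K K' : Type*} [TopologicalSpace K]
  [TopologicalSpace K'] {F : C(K, X)} {L L' : C(K, ℝ)}

theorem IsDevelopment.comp (h : IsDevelopment g F L) (f : C(K', K)) :
    IsDevelopment g (F.comp f) (L.comp f) := fun k k' q => by
  have := h _ _ (q.map f.continuous)
  rwa [Path.map_map] at this

theorem isCoveringMap_angle : IsCoveringMap ((↑) : ℝ → Real.Angle) :=
  AddCircle.isCoveringMap_coe (2 * Real.pi)

/-- Two developments along the same map differ by a constant. -/
theorem IsDevelopment.unique [PathConnectedSpace K] (h : IsDevelopment g F L)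
    (h' : IsDevelopment g F L') (k k' : K) : L k' - L k = L' k' - L' k := by
  have key : (fun a => L a - L k) = fun a => L' a - L' k := by
    refine isCoveringMap_angle.eq_of_comp_eq (by fun_prop) (by fun_prop) (funext fun a => ?_) k
      (by simp)
    exact (h k a (PathConnectedSpace.somePath k a)).trans
      (h' k a (PathConnectedSpace.somePath k a)).symm
  exact congrFun key k'

/-- A homomorphism with values in `ℝ / 2πℤ` is locally exact if it is locally the increment of a
continuous real function. -/
def IsLocallyExact (g : PathGroup X →ₗ[ℤ] Real.Angle) : Prop :=
  ∀ x : X, ∃ U ∈ 𝓝 x, ∃ f : X → ℝ, ContinuousAt f x ∧ ∀ (y : X) (p : Path x y),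
    (∀ t, p t ∈ U) → g (pathClass p) = ((f y - f x : ℝ) : Real.Angle)

/-- On a simply connected space the values of `g` on the paths from a base point define a continuous
map to `ℝ / 2πℤ`, which lifts to the covering space `ℝ`. -/
theorem IsLocallyExact.exists_isDevelopment [SimplyConnectedSpace K] [LocallyPathConnectedSpace K]
    (hg : IsLocallyExact g) (F : C(K, X)) : ∃ L, IsDevelopment g F L := by
  let k₀ : K := Classical.arbitrary K
  let d : K → Real.Angle := fun k =>
    g (pathClass ((PathConnectedSpace.somePath k₀ k).map F.continuous))
  have hd : ∀ (k k' : K) (q : Path k k'), d k' = d k + g (pathClass (q.map F.continuous)) :=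
    fun k k' q => by
      have := (SimplyConnectedSpace.paths_homotopic ((PathConnectedSpace.somePath k₀ k).trans q)
        (PathConnectedSpace.somePath k₀ k')).map F
      have := pathClass_eq_of_homotopic this
      change pathClass ((Path.trans _ _).map F.continuous) =
        pathClass ((PathConnectedSpace.somePath k₀ k').map F.continuous) at this
      rw [Path.map_trans, pathClass_trans] at this
      simp only [d, ← this, map_add]
  have hcont : Continuous d := by
    refine continuous_iff_continuousAt.2 fun k => ?_
    obtain ⟨U, hU, f, hf, hgf⟩ := hg (F k)
    obtain ⟨V, ⟨hV, hVc⟩, hVU⟩ := (path_connected_basis k).mem_iff.1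
      (F.continuous.continuousAt.preimage_mem_nhds hU)
    have h1 : ∀ᶠ k' in 𝓝 k, d k + ((f (F k') - f (F k) : ℝ) : Real.Angle) = d k' := by
      filter_upwards [hV] with k' hk'
      obtain ⟨q, hq⟩ := hVc.joinedIn k (mem_of_mem_nhds hV) k' hk'
      rw [hd k k' q, hgf _ (q.map F.continuous) fun t => hVU (hq t)]
    refine ContinuousAt.congr ?_ h1
    have h2 : ContinuousAt (fun k' => f (F k')) k :=
      ContinuousAt.comp (f := F) (g := f) hf F.continuous.continuousAt
    exact continuousAt_const.add
      (Real.Angle.continuous_coe.continuousAt.comp (h2.sub continuousAt_const))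
  obtain ⟨r, hr⟩ := QuotientAddGroup.mk_surjective (d k₀)
  obtain ⟨L, ⟨-, hL⟩, -⟩ := isCoveringMap_angle.existsUnique_continuousMap_lifts ⟨d, hcont⟩ k₀ r hr
  refine ⟨L, fun k k' q => ?_⟩
  have e : ∀ k, ((L k : ℝ) : Real.Angle) = d k := fun k => congrFun hL k
  rw [Real.Angle.coe_sub, e, e, hd k k' q, add_sub_cancel_left]

/-- A locally exact homomorphism with values in `ℝ / 2πℤ` lifts to a real homomorphism. -/
theorem IsLocallyExact.exists_lift (hg : IsLocallyExact g) :
    ∃ D : PathGroup X →ₗ[ℤ] ℝ, ∀ c, ((D c : ℝ) : Real.Angle) = g c := by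
  have : ContractibleSpace I := (convex_Icc (0 : ℝ) 1).contractibleSpace ⟨0, by simp⟩
  have : LocallyPathConnectedSpace I := (convex_Icc (0 : ℝ) 1).locallyPathConnectedSpace
  have hex : ∀ (x y : X) (p : Path x y), ∃ L, IsDevelopment g p.toContinuousMap L :=
    fun x y p => hg.exists_isDevelopment _
  choose L hL using hex
  obtain ⟨D, hD⟩ := exists_pathGroup_lift (fun x y p => L x y p 1 - L x y p 0)
    (fun x y z p q => by
      let f₁ : C(I, I) := ⟨fun t => ⟨t / 2, by have := t.2.1; have := t.2.2; constructor <;> linarith⟩,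
        by fun_prop⟩
      let f₂ : C(I, I) := ⟨fun t => ⟨(1 + t) / 2, by
        have := t.2.1; have := t.2.2; constructor <;> linarith⟩, by fun_prop⟩
      have e₁ : (p.trans q).toContinuousMap.comp f₁ = p.toContinuousMap := by
        ext t
        change (p.trans q) _ = p t
        rw [Path.trans_apply, dif_pos (by simp only [f₁, ContinuousMap.coe_mk]; linarith [t.2.2])]
        congr 1
        ext; simp [f₁]; ring
      have e₂ : (p.trans q).toContinuousMap.comp f₂ = q.toContinuousMap := by
        ext t
        change (p.trans q) _ = q t
        rcases eq_or_ne t 0 with rfl | ht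
        · rw [Path.trans_apply, dif_pos (by simp [f₂]), q.source]
          refine Eq.trans (congrArg p (Subtype.ext ?_)) p.target
          simp [f₂]
        · have : (0 : ℝ) < t := lt_of_le_of_ne t.2.1 fun h => ht (Subtype.ext h.symm)
          rw [Path.trans_apply, dif_neg (by simp only [f₂, ContinuousMap.coe_mk]; linarith)]
          congr 1
          ext; simp [f₂]; ring
      have h₁ := (hL _ _ p).unique (e₁ ▸ (hL _ _ (p.trans q)).comp f₁) 0 1
      have h₂ := (hL _ _ q).unique (e₂ ▸ (hL _ _ (p.trans q)).comp f₂) 0 1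
      rw [h₁, h₂]
      simp only [ContinuousMap.comp_apply]
      have a1 : f₁ 0 = 0 := by ext; simp [f₁]
      have a2 : f₂ 1 = 1 := by ext; simp [f₂]
      have a3 : f₁ 1 = f₂ 0 := by ext; simp [f₁, f₂]
      rw [a1, a2, a3]
      ring)
    (fun x y p q ⟨H⟩ => by
      obtain ⟨l, hl⟩ := hg.exists_isDevelopment (K := I × I) H.toContinuousMap
      have hp := (hL _ _ p).unique (L' := l.comp (.prodMk (.const _ 0) (.id _))) (by
        convert hl.comp (.prodMk (.const _ 0) (.id _)) using 1
        ext t; simp) 0 1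
      have hq := (hL _ _ q).unique (L' := l.comp (.prodMk (.const _ 1) (.id _))) (by
        convert hl.comp (.prodMk (.const _ 1) (.id _)) using 1
        ext t; simp) 0 1
      have hside : ∀ (z : X) (b : I), (∀ r, H (r, b) = z) → l (0, b) = l (1, b) := fun z b hb => by
        have hc : IsDevelopment g (ContinuousMap.const I z) (ContinuousMap.const I 0) :=
          fun k k' q => by
            have : pathClass (q.map (ContinuousMap.const I z).continuous) =
              pathClass (Path.refl z) := pathClass_congr rfl
            rw [this, pathClass_refl, map_zero]; simp
        have := hc.unique (L' := l.comp (.prodMk (.id _) (.const _ b))) (by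
          convert hl.comp (.prodMk (.id _) (.const _ b)) using 1
          ext t; simpa using (hb t).symm) 1 0
        simp only [ContinuousMap.const_apply, ContinuousMap.comp_apply, sub_self] at this
        exact (sub_eq_zero.1 this.symm)
      rw [hp, hq]
      change l (0, 1) - l (0, 0) = l (1, 1) - l (1, 0)
      rw [hside x 0 (fun r => by simp), hside y 1 (fun r => by simp)])
  refine ⟨D, fun c => ?_⟩
  have : (Real.Angle.coeHom.toIntLinearMap).comp D = g := pathGroup_hom_ext fun x y p => by
    rw [LinearMap.comp_apply, hD]
    refine (hL x y p 0 1 ⟨.id I, rfl, rfl⟩).trans ?_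
    congr 1
  exact LinearMap.congr_fun this c

end Development

end

/-! ### Self-maps that avoid finitely many points -/

section

open Topology

section Push

variable {E : Type*} [NormedAddCommGroup E] [NormedSpace ℝ E]

/-- Moves the points of the ball with centre `c` and radius `r` in the direction of `b`, the centre
by `r * b`, and fixes the points outside the ball. -/
def push (c b : E) (r t : ℝ) (v : E) : E := v + (t * max 0 (r - dist v c)) • b

variable {c b : E} {r : ℝ}

theorem continuous_push : Continuous fun a : I × E => push c b r a.1 a.2 := by
  unfold push; fun_prop

theorem push_zero (v : E) : push c b r 0 v = v := by simp [push]

theorem push_of_notMem {t : ℝ} {v : E} (hv : v ∉ Metric.closedBall c r) : push c b r t v = v := by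
  have : max 0 (r - dist v c) = 0 := max_eq_left (by
    rw [Metric.mem_closedBall, not_le] at hv; linarith)
  simp [push, this]

theorem push_of_mem {t : ℝ} {v : E} (hv : v ∈ Metric.closedBall c r) :
    push c b r t v = v + (t * (r - dist v c)) • b := by
  have : max 0 (r - dist v c) = r - dist v c := max_eq_right (by
    rw [Metric.mem_closedBall] at hv; linarith)
  rw [push, this]

theorem push_mem_closedBall (hb : ‖b‖ ≤ 1 / 2) {t : I} {v : E} (hv : v ∈ Metric.closedBall c r) :
    push c b r t v ∈ Metric.closedBall c r := by
  rw [push_of_mem hv]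
  rw [Metric.mem_closedBall] at hv ⊢
  have h1 : dist (v + ((t : ℝ) * (r - dist v c)) • b) v ≤ r - dist v c := by
    rw [dist_self_add_left, norm_smul, Real.norm_eq_abs,
      abs_of_nonneg (mul_nonneg t.2.1 (by linarith))]
    have := t.2.2; have := t.2.1
    have h0 : 0 ≤ r - dist v c := by linarith
    calc (t : ℝ) * (r - dist v c) * ‖b‖ ≤ 1 * (r - dist v c) * 1 := by gcongr; linarith
      _ = _ := by ring
  linarith [dist_triangle (v + ((t : ℝ) * (r - dist v c)) • b) v c]

theorem push_injective (hb : ‖b‖ ≤ 1 / 2) : Function.Injective (push c b r 1) := by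
  intro v w h
  have h1 : v - w = (max 0 (r - dist w c) - max 0 (r - dist v c)) • b := by
    simp only [push, one_mul] at h
    rw [sub_smul, sub_eq_sub_iff_add_eq_add, h, add_comm]
  have h2 : |max 0 (r - dist w c) - max 0 (r - dist v c)| ≤ dist v w := by
    calc _ ≤ max |0 - 0| |(r - dist w c) - (r - dist v c)| := abs_max_sub_max_le_max _ _ _ _
      _ = |dist v c - dist w c| := by rw [sub_self, abs_zero, max_eq_right (abs_nonneg _)]; congr 1; ring
      _ ≤ dist v w := abs_dist_sub_le v w c
  have h3 : dist v w ≤ dist v w * (1 / 2) := by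
    conv_lhs => rw [dist_eq_norm, h1, norm_smul, Real.norm_eq_abs]
    gcongr
  exact dist_le_zero.1 (by linarith)

end Push

section Removable

variable {X : Type*} [TopologicalSpace X]

/-- Injective self-maps homotopic to the identity. -/
def IsIsotopic (f : C(X, X)) : Prop := Function.Injective f ∧ (ContinuousMap.id X).Homotopic f

theorem IsIsotopic.comp {f g : C(X, X)} (hf : IsIsotopic f) (hg : IsIsotopic g) :
    IsIsotopic (f.comp g) :=
  ⟨hf.1.comp hg.1, by simpa using hf.2.comp hg.2⟩

/-- A point is removable if it is avoided by an injective self-map homotopic to the identity. -/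
def IsRemovable (z : X) : Prop := ∃ f : C(X, X), IsIsotopic f ∧ z ∉ Set.range f

theorem IsRemovable.apply {z : X} (hz : IsRemovable z) {f : C(X, X)} (hf : IsIsotopic f) :
    IsRemovable (f z) := by
  obtain ⟨g, hg, hgz⟩ := hz
  refine ⟨f.comp g, hf.comp hg, ?_⟩
  rintro ⟨y, hy⟩
  exact hgz ⟨y, hf.1 hy⟩

variable [T2Space X] {E : Type*} [NormedAddCommGroup E] [NormedSpace ℝ E] [ProperSpace E]

/-- A push inside a chart with values in a closed set `R` extends by the identity. -/
theorem exists_isIsotopic_push (φ : PartialEquiv X E) (hs : IsOpen φ.source)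
    (hφ : ContinuousOn φ φ.source) (hφ' : ContinuousOn φ.symm φ.target) {R : Set E}
    (hR : IsClosed R) (hr : φ.target ⊆ R) {c b : E} {r : ℝ} (hb : ‖b‖ ≤ 1 / 2)
    (hball : Metric.closedBall c r ∩ R ⊆ φ.target)
    (hrange : ∀ t : I, ∀ v ∈ Metric.closedBall c r ∩ R, push c b r t v ∈ R) :
    ∃ f : C(X, X), IsIsotopic f ∧
      (∀ y ∈ φ.source, f y ∈ φ.source ∧ φ (f y) = push c b r 1 (φ y)) ∧
      ∀ y ∉ φ.source, f y = y := by
  classical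
  have htarget : ∀ (t : I), ∀ v ∈ φ.target, push c b r t v ∈ φ.target := fun t v hv => by
    by_cases hc : v ∈ Metric.closedBall c r
    · exact hball ⟨push_mem_closedBall hb hc, hrange t v ⟨hc, hr hv⟩⟩
    · rwa [push_of_notMem hc]
  let G : I × X → X := fun a => if a.2 ∈ φ.source then φ.symm (push c b r a.1 (φ a.2)) else a.2
  have hG : ∀ (t : I) (y), y ∈ φ.source → G (t, y) = φ.symm (push c b r t (φ y)) :=
    fun t y hy => if_pos hy
  have hG' : ∀ (t : I) (y), y ∉ φ.source → G (t, y) = y := fun t y hy => if_neg hy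
  have hGs : ∀ (t : I) (y), y ∈ φ.source → G (t, y) ∈ φ.source ∧ φ (G (t, y)) = push c b r t (φ y) :=
    fun t y hy => by
      have := htarget t _ (φ.map_source hy)
      rw [hG t y hy]
      exact ⟨φ.map_target this, φ.right_inv this⟩
  have hK : IsClosed (φ.symm '' (Metric.closedBall c r ∩ R)) := by
    refine IsCompact.isClosed (IsCompact.image_of_continuousOn ?_ ?_)
    · exact (isCompact_closedBall c r).inter_right hR
    · exact hφ'.mono hball
  have hcont : Continuous G := by
    refine continuous_iff_continuousAt.2 fun ⟨t, y⟩ => ?_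
    by_cases hy : y ∈ φ.source
    · have hopen : IsOpen (Set.univ ×ˢ φ.source : Set (I × X)) :=
        isOpen_univ.prod hs
      have h1 : ContinuousOn (fun a : I × X => (a.1, φ a.2)) (Set.univ ×ˢ φ.source) :=
        continuousOn_fst.prodMk (hφ.comp continuousOn_snd fun a ha => ha.2)
      have hc : ContinuousOn (fun a : I × X => φ.symm (push c b r a.1 (φ a.2)))
          (Set.univ ×ˢ φ.source) :=
        hφ'.comp (continuous_push.comp_continuousOn h1) fun a ha =>
          htarget _ _ (φ.map_source ha.2)
      refine (hc.congr fun a ha => hG a.1 a.2 ha.2).continuousAt (hopen.mem_nhds ⟨trivial, hy⟩)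
    · have hyK : y ∉ φ.symm '' (Metric.closedBall c r ∩ R) := by
        rintro ⟨v, hv, rfl⟩
        exact hy (φ.map_target (hball hv))
      refine continuousAt_snd.congr ?_
      filter_upwards [continuousAt_snd.preimage_mem_nhds (hK.isOpen_compl.mem_nhds hyK)] with a ha
      by_cases has : a.2 ∈ φ.source
      · have : φ a.2 ∉ Metric.closedBall c r := fun h =>
          ha ⟨φ a.2, ⟨h, hr (φ.map_source has)⟩, φ.left_inv has⟩
        rw [hG a.1 a.2 has, push_of_notMem this, φ.left_inv has]
      · exact (hG' a.1 a.2 has).symm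
  refine ⟨⟨fun y => G (1, y), by fun_prop⟩, ⟨fun y y' h => ?_, ⟨⟨⟨G, hcont⟩, fun y => ?_, fun y => rfl⟩⟩⟩,
    fun y hy => hGs 1 y hy, fun y hy => hG' 1 y hy⟩
  · change G (1, y) = G (1, y') at h
    by_cases hy : y ∈ φ.source <;> by_cases hy' : y' ∈ φ.source
    · refine φ.injOn hy hy' (push_injective hb (c := c) (r := r) ?_)
      exact (hGs 1 y hy).2.symm.trans ((congrArg φ h).trans (hGs 1 y' hy').2)
    · have := (hGs 1 y hy).1
      rw [h, hG' 1 y' hy'] at this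
      exact absurd this hy'
    · have := (hGs 1 y' hy').1
      rw [← h, hG' 1 y hy] at this
      exact absurd this hy
    · rwa [hG' 1 y hy, hG' 1 y' hy'] at h
  · change G (0, y) = y
    by_cases hy : y ∈ φ.source
    · rw [hG 0 y hy]
      refine (congrArg φ.symm (push_zero _)).trans (φ.left_inv hy)
    · exact hG' 0 y hy

end Removable

section Manifold

variable {X : Type*} [TopologicalSpace X] {n : ℕ} [NeZero n]
  [ChartedSpace (EuclideanHalfSpace n) X] [T2Space X]

theorem exists_isIsotopic_push_extChartAt (x : X) {c b : EuclideanSpace ℝ (Fin n)} {r : ℝ}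
    (hb : ‖b‖ ≤ 1 / 2)
    (hball : Metric.closedBall c r ∩ {v | 0 ≤ v 0} ⊆ (extChartAt (𝓡∂ n) x).target)
    (hrange : ∀ (t : I), ∀ v ∈ Metric.closedBall c r ∩ {v | 0 ≤ v 0}, 0 ≤ push c b r t v 0) :
    ∃ f : C(X, X), IsIsotopic f ∧ (∀ y ∈ (extChartAt (𝓡∂ n) x).source,
      f y ∈ (extChartAt (𝓡∂ n) x).source ∧
      extChartAt (𝓡∂ n) x (f y) = push c b r 1 (extChartAt (𝓡∂ n) x y)) ∧
      ∀ y ∉ (extChartAt (𝓡∂ n) x).source, f y = y := by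
  have hR : Set.range (𝓡∂ n) = {v : EuclideanSpace ℝ (Fin n) | 0 ≤ v 0} :=
    range_modelWithCornersEuclideanHalfSpace n
  refine exists_isIsotopic_push _ (isOpen_extChartAt_source x) (continuousOn_extChartAt x)
    (continuousOn_extChartAt_symm x) (R := {v : EuclideanSpace ℝ (Fin n) | 0 ≤ v 0}) ?_ ?_ hb
    hball hrange
  · exact hR ▸ (𝓡∂ n).isClosed_range
  · exact hR ▸ extChartAt_target_subset_range x

/-- Points of a chart ball that does not meet the boundary are moved to each other. -/
theorem exists_isIsotopic_apply_eq (x : X) {y y' : X} {r : ℝ} (hr : 0 < r)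
    (hy : y ∈ (extChartAt (𝓡∂ n) x).source) (hy' : y' ∈ (extChartAt (𝓡∂ n) x).source)
    (hball : Metric.closedBall (extChartAt (𝓡∂ n) x y) r ⊆ (extChartAt (𝓡∂ n) x).target)
    (hd : dist (extChartAt (𝓡∂ n) x y') (extChartAt (𝓡∂ n) x y) ≤ r / 2) :
    ∃ f : C(X, X), IsIsotopic f ∧ f y = y' := by
  set c := extChartAt (𝓡∂ n) x y
  set b := r⁻¹ • (extChartAt (𝓡∂ n) x y' - c)
  have hR : Set.range (𝓡∂ n) = {v : EuclideanSpace ℝ (Fin n) | 0 ≤ v 0} :=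
    range_modelWithCornersEuclideanHalfSpace n
  have hb : ‖b‖ ≤ 1 / 2 := by
    rw [norm_smul, ← dist_eq_norm, Real.norm_eq_abs, abs_of_pos (inv_pos.2 hr), inv_mul_le_iff₀ hr]
    linarith
  obtain ⟨f, hf, hfs, -⟩ := exists_isIsotopic_push_extChartAt x hb (c := c) (r := r)
    (fun v hv => hball hv.1) (fun t v hv => by
      have : push c b r t v ∈ Set.range (𝓡∂ n) :=
        extChartAt_target_subset_range x (hball (push_mem_closedBall hb hv.1))
      rwa [hR] at this)
  refine ⟨f, hf, (extChartAt (𝓡∂ n) x).injOn (hfs y hy).1 hy' ?_⟩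
  rw [(hfs y hy).2, push_of_mem (Metric.mem_closedBall_self hr.le), dist_self, sub_zero, one_mul,
    smul_inv_smul₀ hr.ne', add_sub_cancel]

/-- Near a boundary point, the manifold is pushed inwards off each point. -/
theorem eventually_isRemovable_of_boundary (x : X) (hx : extChartAt (𝓡∂ n) x x 0 = 0) :
    ∀ᶠ y in 𝓝 x, IsRemovable y := by
  have hR : Set.range (𝓡∂ n) = {v : EuclideanSpace ℝ (Fin n) | 0 ≤ v 0} :=
    range_modelWithCornersEuclideanHalfSpace n
  set c := extChartAt (𝓡∂ n) x x
  have hn : (extChartAt (𝓡∂ n) x).target ∈ 𝓝[Set.range (𝓡∂ n)] c :=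
    extChartAt_target_mem_nhdsWithin x
  obtain ⟨r, hr, hball⟩ := (nhdsWithin_hasBasis Metric.nhds_basis_closedBall _).mem_iff.1 hn
  rw [hR] at hball
  set b : EuclideanSpace ℝ (Fin n) := EuclideanSpace.single 0 (1 / 2)
  have hb : ‖b‖ ≤ 1 / 2 := by simp [b]
  have hb0 : b 0 = 1 / 2 := by simp [b]
  obtain ⟨f, hf, hfs, hfn⟩ := exists_isIsotopic_push_extChartAt x hb (c := c) (r := r)
    hball (fun t v hv => by
      have h0 : 0 ≤ v 0 := hv.2
      have h1 := hv.1
      rw [Metric.mem_closedBall] at h1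
      rw [push_of_mem hv.1, PiLp.add_apply, PiLp.smul_apply, hb0, smul_eq_mul]
      have := mul_nonneg t.2.1 (sub_nonneg.2 h1)
      linarith)
  have hev : ∀ᶠ y in 𝓝 x, y ∈ (extChartAt (𝓡∂ n) x).source ∧
      extChartAt (𝓡∂ n) x y ∈ Metric.ball c (r / 8) := by
    refine Filter.Eventually.and (extChartAt_source_mem_nhds x) ?_
    exact (continuousAt_extChartAt x).preimage_mem_nhds (Metric.ball_mem_nhds _ (by linarith))
  filter_upwards [hev] with y hy
  refine ⟨f, hf, ?_⟩
  rintro ⟨z, hz⟩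
  have hzs : z ∈ (extChartAt (𝓡∂ n) x).source := by
    by_contra h
    rw [hfn z h] at hz
    exact h (hz ▸ hy.1)
  -- The push raises the first coordinate of the points near the centre by more than `r / 8`.
  have h1 := (hfs z hzs).2
  rw [hz] at h1
  set v := extChartAt (𝓡∂ n) x z
  set w := extChartAt (𝓡∂ n) x y
  have hv0 : 0 ≤ v 0 := by
    have : v ∈ Set.range (𝓡∂ n) :=
      extChartAt_target_subset_range x ((extChartAt (𝓡∂ n) x).map_source hzs)
    rwa [hR] at this
  have hw := hy.2
  rw [Metric.mem_ball] at hw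
  have hw0 : w 0 < r / 8 := by
    have h2 : |w 0 - c 0| ≤ dist w c := by
      rw [dist_eq_norm, ← Real.norm_eq_abs, ← PiLp.sub_apply]
      exact PiLp.norm_apply_le _ _
    rw [hx, sub_zero] at h2
    exact lt_of_le_of_lt (le_abs_self _) (h2.trans_lt hw)
  have h3 : w 0 = v 0 + max 0 (r - dist v c) * (1 / 2) := by
    rw [h1, push, PiLp.add_apply, PiLp.smul_apply, hb0, smul_eq_mul, one_mul]
  have h4 : dist v w ≤ max 0 (r - dist v c) * (1 / 2) := by
    rw [h1, push, one_mul, dist_self_add_right, norm_smul, Real.norm_eq_abs,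
      abs_of_nonneg (le_max_left _ _)]
    gcongr
  have h5 := le_max_right 0 (r - dist v c)
  linarith [dist_triangle v w c]

/-- The removable points of a connected manifold form an open and closed set, since the points of a
chart ball are moved to each other, and this set contains the points of the boundary. -/
theorem isRemovable [PreconnectedSpace X] {x₀ : X} (hx₀ : x₀ ∈ (𝓡∂ n).boundary X) (z : X) :
    IsRemovable z := by
  have hR : Set.range (𝓡∂ n) = {v : EuclideanSpace ℝ (Fin n) | 0 ≤ v 0} :=
    range_modelWithCornersEuclideanHalfSpace n
  have key : ∀ x : X, (∀ᶠ y in 𝓝 x, IsRemovable y) ∨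
      ∀ᶠ y in 𝓝 x, (IsRemovable x ↔ IsRemovable y) := by
    intro x
    set c := extChartAt (𝓡∂ n) x x with hc
    have h0 : 0 ≤ c 0 := by
      have : c ∈ Set.range (𝓡∂ n) :=
        extChartAt_target_subset_range x (mem_extChartAt_target x)
      rwa [hR] at this
    rcases h0.eq_or_lt' with h0 | h0
    · exact Or.inl (eventually_isRemovable_of_boundary x h0)
    · right
      have hn : (extChartAt (𝓡∂ n) x).target ∈ 𝓝 c := by
        have h1 : (extChartAt (𝓡∂ n) x).target ∈ 𝓝[Set.range (𝓡∂ n)] c :=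
          extChartAt_target_mem_nhdsWithin x
        rwa [nhdsWithin_eq_nhds.2] at h1
        rw [hR]
        have : IsOpen {v : EuclideanSpace ℝ (Fin n) | 0 < v 0} :=
          isOpen_lt continuous_const (by fun_prop)
        exact Filter.mem_of_superset (this.mem_nhds h0) fun v (hv : 0 < v 0) => le_of_lt hv
      obtain ⟨r, hr, hball⟩ := Metric.nhds_basis_closedBall.mem_iff.1 hn
      have hev : ∀ᶠ y in 𝓝 x, y ∈ (extChartAt (𝓡∂ n) x).source ∧
          extChartAt (𝓡∂ n) x y ∈ Metric.ball c (r / 4) := by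
        refine Filter.Eventually.and (extChartAt_source_mem_nhds x) ?_
        exact (continuousAt_extChartAt x).preimage_mem_nhds (Metric.ball_mem_nhds _ (by linarith))
      filter_upwards [hev] with y ⟨hys, hy⟩
      rw [Metric.mem_ball] at hy
      obtain ⟨f, hf, hfx⟩ := exists_isIsotopic_apply_eq x (y := x) (y' := y) (half_pos hr)
        (mem_extChartAt_source x) hys ((Metric.closedBall_subset_closedBall (by linarith)).trans
          hball) (by linarith)
      obtain ⟨g, hg, hgy⟩ := exists_isIsotopic_apply_eq x (y := y) (y' := x) (half_pos hr)
        hys (mem_extChartAt_source x) ((Metric.closedBall_subset_closedBall' (by linarith)).trans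
          hball) (by rw [dist_comm]; linarith)
      exact ⟨fun h => hfx ▸ h.apply hf, fun h => hgy ▸ h.apply hg⟩
  have hclopen : IsClopen {z : X | IsRemovable z} := by
    refine ⟨⟨isOpen_iff_mem_nhds.2 fun x hx => ?_⟩, isOpen_iff_mem_nhds.2 fun x hx => ?_⟩
    · rcases key x with h | h
      · exact absurd h.self_of_nhds hx
      · filter_upwards [h] with y hy
        exact fun h => hx (hy.2 h)
    · rcases key x with h | h
      · exact h
      · filter_upwards [h] with y hy
        exact hy.1 hx
  have hne : {z : X | IsRemovable z}.Nonempty := by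
    refine ⟨x₀, (eventually_isRemovable_of_boundary (n := n) x₀ ?_).self_of_nhds⟩
    rw [ModelWithCorners.boundary, Set.mem_ofPred_eq, ModelWithCorners.IsBoundaryPoint,
      frontier_range_modelWithCornersEuclideanHalfSpace] at hx₀
    exact hx₀.symm
  exact Set.eq_univ_iff_forall.1 (hclopen.eq_univ hne) z

/-- A finite set of points is avoided by a self-map homotopic to the identity. -/
theorem exists_isIsotopic_disjoint [PreconnectedSpace X] {x₀ : X} (hx₀ : x₀ ∈ (𝓡∂ n).boundary X)
    {Z : Set X} (hZ : Z.Finite) : ∃ f : C(X, X), IsIsotopic f ∧ Disjoint (Set.range f) Z := by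
  induction hk : Z.ncard using Nat.strong_induction_on generalizing Z with
  | _ k ih =>
    rcases Z.eq_empty_or_nonempty with rfl | ⟨z, hz⟩
    · exact ⟨.id X, ⟨Function.injective_id, .refl _⟩, Set.disjoint_empty _⟩
    obtain ⟨f, hf, hfz⟩ := isRemovable hx₀ z
    have hlt : (f ⁻¹' Z).ncard < k := by
      rw [← hk, ← Set.ncard_image_of_injective _ hf.1]
      refine Set.ncard_lt_ncard ⟨Set.image_preimage_subset f Z, fun h => hfz ?_⟩ hZ
      exact Set.image_subset_range f _ (h hz)
    obtain ⟨g, hg, hgd⟩ := ih _ hlt (hZ.preimage hf.1.injOn) rfl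
    refine ⟨f.comp g, hf.comp hg, Set.disjoint_left.2 ?_⟩
    rintro _ ⟨y, rfl⟩ hy
    exact Set.disjoint_left.1 hgd ⟨y, rfl⟩ hy

end Manifold

end

/-! ### Generic linear combinations have nondegenerate zeros -/

section

open Topology

section Sard

open MeasureTheory

variable {E : Type*} [NormedAddCommGroup E] [NormedSpace ℝ E] {ι : Type*} [Fintype ι]
  {a : ι → E → ℂ} {a' : ι → E → E →L[ℝ] ℂ} {K : Set E}

/-- The coefficient vectors `w` for which the linear combination `∑ wⱼ aⱼ` of complex functions
has a degenerate zero in `K`; here `a' j x` plays the role of the derivative of `a j` at `x`. -/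
def degenerateCoeffs (a : ι → E → ℂ) (a' : ι → E → E →L[ℝ] ℂ) (K : Set E) : Set (ι → ℂ) :=
  {w | ∃ x ∈ K, ∑ j, w j * a j x = 0 ∧ ¬ Function.Injective (∑ j, w j • a' j x : E →L[ℝ] ℂ)}

theorem det_comp_eq_zero_iff [FiniteDimensional ℝ E] (e : ℂ ≃L[ℝ] E) (f : E →L[ℝ] ℂ) :
    ((e : ℂ →L[ℝ] E).comp f).det = 0 ↔ ¬ Function.Injective f := by
  rw [← not_iff_not, not_not, ← Ne, ← isUnit_iff_ne_zero, ContinuousLinearMap.det,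
    ← LinearMap.isUnit_iff_isUnit_det, LinearMap.isUnit_iff_ker_eq_bot, LinearMap.ker_eq_bot]
  constructor
  · intro h x y hxy
    exact h (by simp [hxy])
  · intro h x y hxy
    exact h (e.injective (by simpa using hxy))

/-- The degenerate coefficients form the projection of a closed set along the compact set `K`. -/
theorem isOpen_compl_degenerateCoeffs [FiniteDimensional ℝ E] (hE : Module.finrank ℝ E = 2)
    (hK : IsCompact K) (ha : ∀ j, ContinuousOn (a j) K) (ha' : ∀ j, ContinuousOn (a' j) K) :
    IsOpen (degenerateCoeffs a a' K)ᶜ := by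
  rw [isOpen_compl_iff]
  let e : ℂ ≃L[ℝ] E := ContinuousLinearEquiv.ofFinrankEq (by rw [hE, Complex.finrank_real_complex])
  have : CompactSpace K := isCompact_iff_compactSpace.1 hK
  have h1 : IsClosed {p : K × (ι → ℂ) | ∑ j, p.2 j * a j p.1 = 0 ∧
      ((e : ℂ →L[ℝ] E).comp (∑ j, p.2 j • a' j p.1)).det = 0} := by
    have hc : ∀ j, Continuous fun x : K => a j x := fun j => (ha j).domRestrict
    have hc' : ∀ j, Continuous fun x : K => a' j x := fun j => (ha' j).domRestrict
    refine IsClosed.inter (isClosed_eq ?_ continuous_const)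
      (isClosed_eq (ContinuousLinearMap.continuous_det.comp
        (continuous_const.clm_comp ?_)) continuous_const)
    · exact continuous_finsetSum _ fun j _ => ((continuous_apply j).comp continuous_snd).mul
        ((hc j).comp continuous_fst)
    · exact continuous_finsetSum _ fun j _ => ((continuous_apply j).comp continuous_snd).smul
        ((hc' j).comp continuous_fst)
  convert isClosedMap_snd_of_compactSpace _ h1 using 1
  ext w
  simp only [degenerateCoeffs, det_comp_eq_zero_iff]
  constructor
  · rintro ⟨x, hx, h⟩
    exact ⟨(⟨x, hx⟩, w), h, rfl⟩
  · rintro ⟨⟨x, w⟩, h, rfl⟩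
    exact ⟨x, x.2, h⟩

/-- By Sard's theorem, zeros in `K` of a generic linear combination are nondegenerate, if one of
the functions is constant. -/
theorem dense_compl_degenerateCoeffs [FiniteDimensional ℝ E] [DecidableEq ι]
    (hE : Module.finrank ℝ E = 2) {T : Set E} (hKT : K ⊆ T)
    (ha : ∀ j, ∀ x ∈ K, HasFDerivWithinAt (a j) (a' j x) T x) {i : ι} (hi : ∀ x ∈ K, a i x = 1)
    (hi' : ∀ x ∈ K, a' i x = 0) : Dense (degenerateCoeffs a a' K)ᶜ := by
  borelize E
  let e : ℂ ≃L[ℝ] E := ContinuousLinearEquiv.ofFinrankEq (by rw [hE, Complex.finrank_real_complex])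
  intro w
  -- The critical values of `e ∘ ∑ wⱼ aⱼ` on `K` are a null set.
  let F : E → E := fun x => e (∑ j, w j * a j x)
  let F' : E → E →L[ℝ] E := fun x => (e : ℂ →L[ℝ] E).comp (∑ j, w j • a' j x)
  let C : Set E := {x | x ∈ K ∧ (F' x).det = 0}
  have hnull : Measure.addHaar (F '' C) = 0 := by
    refine addHaar_image_eq_zero_of_det_fderivWithin_eq_zero _ (f' := F') (fun x hx => ?_)
      fun x hx => hx.2
    refine HasFDerivWithinAt.mono ?_ fun y hy => hKT hy.1
    refine (e : ℂ →L[ℝ] E).hasFDerivAt.comp_hasFDerivWithinAt x ?_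
    refine HasFDerivWithinAt.fun_sum fun j _ => ?_
    exact (ha j x hx.1).const_smul (w j)
  have hdense : Dense (F '' C)ᶜ :=
    interior_eq_empty_iff_dense_compl.1 (Measure.interior_eq_empty_of_null hnull)
  have hmem : ∀ v ∈ (F '' C)ᶜ, (fun j => w j - if j = i then e.symm v else 0) ∈
      (degenerateCoeffs a a' K)ᶜ := by
    rintro v hv ⟨x, hx, h0, hinj⟩
    replace h0 : ∑ j, (w j - if j = i then e.symm v else 0) * a j x = 0 := h0
    simp only [sub_mul, Finset.sum_sub_distrib, ite_mul, zero_mul, Finset.sum_ite_eq',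
      Finset.mem_univ, if_true, hi x hx, mul_one] at h0
    have h1 : (∑ j, (w j - if j = i then e.symm v else 0) • a' j x : E →L[ℝ] ℂ) =
        ∑ j, w j • a' j x := by
      refine Finset.sum_congr rfl fun j _ => ?_
      split_ifs with hj
      · rw [hj, hi' x hx]
        ext y
        simp
      · rw [sub_zero]
    rw [h1] at hinj
    refine hv ⟨x, ⟨hx, (det_comp_eq_zero_iff e _).2 hinj⟩, ?_⟩
    change e (∑ j, w j * a j x) = v
    rw [sub_eq_zero.1 h0, e.apply_symm_apply]
  have hcont : Continuous fun v : E => fun j => w j - if j = i then e.symm v else 0 := by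
    refine continuous_pi fun j => ?_
    split_ifs <;> fun_prop
  have := hdense 0
  have h2 := mem_closure_image hcont.continuousAt this
  simp only [map_zero, ite_self, sub_zero] at h2
  refine closure_mono ?_ h2
  rintro _ ⟨v, hv, rfl⟩
  exact hmem v hv

/-- A nondegenerate zero is isolated. -/
theorem eventually_ne_of_injective [FiniteDimensional ℝ E] {f : E → ℂ} {f' : E →L[ℝ] ℂ}
    {T : Set E} {x : E} (h : HasFDerivWithinAt f f' T x) (hf' : Function.Injective f') (c : ℂ) :
    ∀ᶠ y in 𝓝[T \ {x}] x, f y ≠ c := by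
  refine h.eventually_ne ?_
  obtain ⟨C, hC, hC'⟩ := LinearMap.exists_antilipschitzWith (f' : E →ₗ[ℝ] ℂ)
    (LinearMap.ker_eq_bot.2 hf')
  exact ⟨C, hC'⟩

end Sard

end

/-! ### Sections of flat line bundles on a surface -/

section

open Topology

section Potential

variable {S : Type u} [TopologicalSpace S]

/-- An angle-valued function is a potential on `U` of a homomorphism defined on paths if its
increments are the values of the homomorphism on the paths in `U`. -/
def IsPotential (g : PathGroup S →ₗ[ℤ] Real.Angle) (U : Set S) (A : S → Real.Angle) : Prop :=
  ∀ (y y' : S) (p : Path y y'), (∀ t, p t ∈ U) → g (pathClass p) = A y' - A y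

variable {g : PathGroup S →ₗ[ℤ] Real.Angle}

/-- The difference of two potentials is locally constant. -/
theorem IsPotential.eventually_sub_eq [LocallyPathConnectedSpace S] {U U' : Set S}
    {A A' : S → Real.Angle} (h : IsPotential g U A) (h' : IsPotential g U' A') (hU : IsOpen U)
    (hU' : IsOpen U') {y : S} (hy : y ∈ U) (hy' : y ∈ U') :
    ∀ᶠ z in 𝓝 y, A' z - A z = A' y - A y := by
  obtain ⟨V, ⟨hV, hVc⟩, hVU⟩ := (path_connected_basis y).mem_iff.1
    ((hU.inter hU').mem_nhds ⟨hy, hy'⟩)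
  filter_upwards [hV] with z hz
  obtain ⟨p, hp⟩ := hVc.joinedIn y (mem_of_mem_nhds hV) z hz
  have h1 := h _ _ p fun t => (hVU (hp t)).1
  have h2 := h' _ _ p fun t => (hVU (hp t)).2
  rw [h1, sub_eq_sub_iff_add_eq_add] at h2
  rw [sub_eq_sub_iff_add_eq_add, ← h2, add_comm]

/-- A homomorphism has a potential on the support of a bump function, as this is a convex set in a
chart. -/
theorem exists_isPotential {n : ℕ} [NeZero n] [ChartedSpace (EuclideanHalfSpace n) S]
    (g : PathGroup S →ₗ[ℤ] Real.Angle) {c : S} (f : SmoothBumpFunction (𝓡∂ n) c) :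
    ∃ A, IsPotential g (Function.support f) A := by
  set φ := extChartAt (𝓡∂ n) c
  let B : Set (EuclideanSpace ℝ (Fin n)) := Metric.ball (φ c) f.rOut ∩ Set.range (𝓡∂ n)
  have hconv : Convex ℝ B := (convex_ball _ _).inter (𝓡∂ n).convex_range
  have hBt : B ⊆ φ.target := f.ball_subset
  have hsupp : ∀ y ∈ Function.support f, y ∈ φ.source ∧ φ y ∈ B := fun y hy => by
    rw [f.support_eq_symm_image] at hy
    obtain ⟨v, hv, rfl⟩ := hy
    refine ⟨φ.map_target (hBt hv), ?_⟩
    rwa [φ.right_inv (hBt hv)]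
  have hne : B.Nonempty := ⟨φ c, (hsupp c f.c_mem_support).2⟩
  have : ContractibleSpace B := hconv.contractibleSpace hne
  let F : C(B, S) := ⟨fun v => φ.symm v,
    ((continuousOn_extChartAt_symm c).mono hBt).domRestrict⟩
  let b₀ : B := ⟨φ c, (hsupp c f.c_mem_support).2⟩
  classical
  refine ⟨fun y => if h : φ y ∈ B then
    g (pathClass ((PathConnectedSpace.somePath b₀ ⟨φ y, h⟩).map F.continuous)) else 0, ?_⟩
  intro y y' p hp
  have hy : φ y ∈ B := (hsupp y (by simpa using hp 0)).2
  have hy' : φ y' ∈ B := (hsupp y' (by simpa using hp 1)).2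
  let q : Path (⟨φ y, hy⟩ : B) ⟨φ y', hy'⟩ :=
    { toFun := fun t => ⟨φ (p t), (hsupp _ (hp t)).2⟩
      continuous_toFun := Continuous.subtype_mk
        ((continuousOn_extChartAt c).comp_continuous p.continuous fun t => (hsupp _ (hp t)).1) _
      source' := by simp
      target' := by simp }
  have h1 : pathClass (q.map F.continuous) = pathClass p := by
    refine pathClass_congr (funext fun t => ?_)
    exact φ.left_inv (hsupp _ (hp t)).1
  have h2 := pathClass_eq_of_homotopic ((SimplyConnectedSpace.paths_homotopic
    ((PathConnectedSpace.somePath b₀ _).trans q) (PathConnectedSpace.somePath b₀ _)).map F)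
  change pathClass ((Path.trans _ _).map F.continuous) = pathClass (Path.map _ F.continuous) at h2
  rw [Path.map_trans, pathClass_trans, h1] at h2
  simp only [dif_pos hy, dif_pos hy', ← h2, map_add, add_sub_cancel_left]

end Potential

section TwistedSum

variable {S : Type u} {ι : Type*}

/-- A linear combination of functions `fⱼ`, twisted by the angles `Aⱼ`. If these are potentials of
a homomorphism on the supports of the `fⱼ`, this is a section of the flat line bundle which the
homomorphism defines. -/
def twistedSum [Fintype ι] (f : ι → S → ℝ) (A : ι → S → Real.Angle) (w : ι → ℂ) (y : S) : ℂ :=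
  ∑ j, w j * (f j y * (A j y).toCircle)

/-- The ratio of the `j`-th and the `i`-th twisted function. -/
def twistedRatio (f : ι → S → ℝ) (A : ι → S → Real.Angle) (i j : ι) (y : S) : ℂ :=
  f j y / f i y * (A j y - A i y).toCircle

variable {f : ι → S → ℝ} {A : ι → S → Real.Angle} {i j : ι} {y : S}

theorem twistedRatio_self (hi : f i y ≠ 0) : twistedRatio f A i i y = 1 := by
  simp [twistedRatio, hi]

theorem twistedSum_eq [Fintype ι] (hi : f i y ≠ 0) (w : ι → ℂ) :
    twistedSum f A w y =
      f i y * (A i y).toCircle * ∑ j, w j * twistedRatio f A i j y := by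
  rw [twistedSum, Finset.mul_sum]
  refine Finset.sum_congr rfl fun j _ => ?_
  have hi' : (f i y : ℂ) ≠ 0 := by exact_mod_cast hi
  rw [twistedRatio, sub_eq_add_neg, Real.Angle.toCircle_add, Real.Angle.toCircle_neg,
    Circle.coe_mul, Circle.coe_inv]
  have := Circle.coe_ne_zero (A i y).toCircle
  field_simp

variable [TopologicalSpace S] [ChartedSpace (EuclideanHalfSpace 2) S]
  {g : PathGroup S →ₗ[ℤ] Real.Angle} {U : ι → Set S}

/-- The angles enter the ratio only through the difference of two potentials, which is locally
constant. -/
theorem contMDiffAt_twistedRatio (hU : ∀ i, IsOpen (U i)) (hA : ∀ i, IsPotential g (U i) (A i))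
    (hf : ∀ i, ContMDiff (𝓡∂ 2) 𝓘(ℝ, ℝ) ∞ (f i)) (hfU : ∀ i, tsupport (f i) ⊆ U i)
    (hi : f i y ≠ 0) (j : ι) :
    ContMDiffAt (𝓡∂ 2) 𝓘(ℝ, ℂ) ∞ (twistedRatio f A i j) y := by
  have : LocallyPathConnectedSpace S :=
    ChartedSpace.locallyPathConnectedSpace (EuclideanHalfSpace 2) S
  by_cases hy : y ∈ tsupport (f j)
  · have h1 : ContMDiffAt (𝓡∂ 2) 𝓘(ℝ, ℝ) ∞ (fun z => f j z / f i z) y :=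
      (hf j).contMDiffAt.div₀ (hf i).contMDiffAt hi
    have h2 : ContMDiff 𝓘(ℝ, ℝ) 𝓘(ℝ, ℂ) ∞
        fun t : ℝ => (t : ℂ) * (A j y - A i y).toCircle :=
      contMDiff_iff_contDiff.2 (Complex.ofRealCLM.contDiff.mul contDiff_const)
    refine (h2.contMDiffAt.comp y h1).congr_of_eventuallyEq ?_
    filter_upwards [(hA i).eventually_sub_eq (hA j) (hU i) (hU j)
      (hfU i (subset_tsupport _ hi)) (hfU j hy)] with z hz
    rw [twistedRatio, hz, Function.comp_apply, Complex.ofReal_div]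
  · refine (contMDiffAt_const (c := (0 : ℂ))).congr_of_eventuallyEq ?_
    filter_upwards [(isClosed_tsupport (f j)).isOpen_compl.mem_nhds hy] with z hz
    rw [twistedRatio, image_eq_zero_of_notMem_tsupport hz]
    simp

/-- For generic coefficients, the zeros of a twisted sum are isolated, hence finite in number. -/
theorem exists_finite_zeros_twistedSum [Fintype ι] [CompactSpace S] [IsManifold (𝓡∂ 2) ∞ S]
    (hU : ∀ i, IsOpen (U i)) (hA : ∀ i, IsPotential g (U i) (A i))
    (hf : ∀ i, ContMDiff (𝓡∂ 2) 𝓘(ℝ, ℝ) ∞ (f i)) (hfU : ∀ i, tsupport (f i) ⊆ U i)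
    {c : ι → S} (hUc : ∀ i, U i ⊆ (extChartAt (𝓡∂ 2) (c i)).source)
    (hcov : ∀ y, ∃ i, 1 / 2 ≤ f i y) :
    ∃ w : ι → ℂ, {y | twistedSum f A w y = 0}.Finite := by
  classical
  have : IsManifold (𝓡∂ 2) 1 S := IsManifold.of_le (n := ∞) (by simp)
  let φ := fun i => extChartAt (𝓡∂ 2) (c i)
  -- In the chart `φ i`, the section is described by the functions `a i j`.
  let a : ι → ι → EuclideanSpace ℝ (Fin 2) → ℂ := fun i j => twistedRatio f A i j ∘ (φ i).symm
  let V : ι → Set S := fun i => {y | f i y ≠ 0}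
  have hV : ∀ i, IsOpen (V i) := fun i => isOpen_ne_fun (hf i).continuous continuous_const
  have hVs : ∀ i, V i ⊆ (φ i).source := fun i y hy => hUc i (hfU i (subset_tsupport _ hy))
  let T : ι → Set (EuclideanSpace ℝ (Fin 2)) := fun i => (φ i).target ∩ (φ i).symm ⁻¹' V i
  have hT : ∀ i, UniqueDiffOn ℝ (T i) := fun i =>
    (hV i).uniqueMDiffOn.uniqueDiffOn_target_inter (c i)
  have ha : ∀ i j, ContDiffOn ℝ 1 (a i j) (T i) := fun i j => by
    have h1 : ContMDiffOn (𝓡∂ 2) 𝓘(ℝ, ℂ) 1 (twistedRatio f A i j) (V i) := fun y hy =>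
      ((contMDiffAt_twistedRatio hU hA hf hfU hy j).of_le (by simp)).contMDiffWithinAt
    exact (h1.comp ((contMDiffOn_extChartAt_symm (c i)).mono Set.inter_subset_left)
      fun v hv => hv.2).contDiffOn
  let a' := fun i j => fderivWithin ℝ (a i j) (T i)
  let K : ι → Set S := fun i => {y | 1 / 2 ≤ f i y}
  have hK : ∀ i, IsCompact (K i) := fun i =>
    (isClosed_le continuous_const (hf i).continuous).isCompact
  have hKV : ∀ i, K i ⊆ V i := fun i y hy => by
    have : (1 : ℝ) / 2 ≤ f i y := hy
    change f i y ≠ 0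
    linarith
  have hφK : ∀ i, φ i '' K i ⊆ T i := by
    rintro i _ ⟨y, hy, rfl⟩
    have hy' := hVs i (hKV i hy)
    refine ⟨(φ i).map_source hy', ?_⟩
    rw [Set.mem_preimage, (φ i).left_inv hy']
    exact hKV i hy
  have hKc : ∀ i, IsCompact (φ i '' K i) := fun i =>
    (hK i).image_of_continuousOn ((continuousOn_extChartAt _).mono ((hKV i).trans (hVs i)))
  have hE : Module.finrank ℝ (EuclideanSpace ℝ (Fin 2)) = 2 := by simp
  have hai : ∀ i, ∀ v ∈ T i, a i i v = 1 := fun i v hv => twistedRatio_self hv.2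
  have hai' : ∀ i, ∀ v ∈ T i, a' i i v = 0 := fun i v hv => by
    have : fderivWithin ℝ (a i i) (T i) v = fderivWithin ℝ (fun _ => (1 : ℂ)) (T i) v :=
      fderivWithin_congr (hai i) (hai i v hv)
    rw [fderivWithin_const_apply] at this
    exact this
  have hderiv : ∀ i j, ∀ v ∈ T i, HasFDerivWithinAt (a i j) (a' i j v) (T i) v :=
    fun i j v hv => ((ha i j).differentiableOn (by simp) v hv).hasFDerivWithinAt
  obtain ⟨w, hw⟩ : (⋂ i, (degenerateCoeffs (a i) (a' i) (φ i '' K i))ᶜ).Nonempty := by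
    refine Dense.nonempty (dense_iInter_of_isOpen (fun i => ?_) fun i => ?_)
    · exact isOpen_compl_degenerateCoeffs hE (hKc i)
        (fun j => (ha i j).continuousOn.mono (hφK i))
        fun j => ((ha i j).continuousOn_fderivWithin (hT i) le_rfl).mono (hφK i)
    · exact dense_compl_degenerateCoeffs hE (hφK i) (fun j v hv => hderiv i j v (hφK i hv))
        (i := i) (fun v hv => hai i v (hφK i hv)) fun v hv => hai' i v (hφK i hv)
  rw [Set.mem_iInter] at hw
  refine ⟨w, ?_⟩
  -- Every point has a punctured neighbourhood without zeros.
  have key : ∀ y, ∀ᶠ z in 𝓝[≠] y, twistedSum f A w z ≠ 0 := by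
    intro y
    obtain ⟨i, hi⟩ := hcov y
    have hyV : y ∈ V i := hKV i hi
    let H : EuclideanSpace ℝ (Fin 2) → ℂ := fun v => ∑ j, w j * a i j v
    have hz : ∀ z ∈ V i, (twistedSum f A w z ≠ 0 ↔ H (φ i z) ≠ 0) := fun z hz => by
      have hz' : f i z ≠ 0 := hz
      have h1 : H (φ i z) = ∑ j, w j * twistedRatio f A i j z := by
        simp only [H, a, Function.comp_apply, (φ i).left_inv (hVs i hz)]
      rw [h1, twistedSum_eq hz']
      simp [hz', Circle.coe_ne_zero]
    have hT' : φ i y ∈ T i := hφK i ⟨y, hi, rfl⟩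
    have hHd : HasFDerivWithinAt H (∑ j, w j • a' i j (φ i y)) (T i) (φ i y) :=
      HasFDerivWithinAt.fun_sum fun j _ => (hderiv i j _ hT').const_smul (w j)
    have hev : ∀ᶠ v in 𝓝[T i \ {φ i y}] φ i y, H v ≠ 0 := by
      by_cases h0 : H (φ i y) = 0
      · refine eventually_ne_of_injective hHd ?_ 0
        by_contra hinj
        exact hw i ⟨φ i y, ⟨y, hi, rfl⟩, h0, hinj⟩
      · exact (hHd.continuousWithinAt.mono Set.sdiff_subset).eventually_ne h0
    have htend : Filter.Tendsto (φ i) (𝓝[≠] y) (𝓝[T i \ {φ i y}] φ i y) := by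
      refine tendsto_nhdsWithin_iff.2 ⟨?_, ?_⟩
      · exact (continuousAt_extChartAt' (hVs i hyV)).tendsto.mono_left nhdsWithin_le_nhds
      · filter_upwards [mem_nhdsWithin_of_mem_nhds ((hV i).mem_nhds hyV), self_mem_nhdsWithin]
          with z hz hzy
        refine ⟨⟨(φ i).map_source (hVs i hz), ?_⟩, fun h => hzy ?_⟩
        · rw [Set.mem_preimage, (φ i).left_inv (hVs i hz)]
          exact hz
        · exact (φ i).injOn (hVs i hz) (hVs i hyV) h
    filter_upwards [htend.eventually hev,
      mem_nhdsWithin_of_mem_nhds ((hV i).mem_nhds hyV)] with z h1 h2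
    exact (hz z h2).2 h1
  by_contra hinf
  obtain ⟨y, hy⟩ := Set.Infinite.exists_accPt_principal hinf
  obtain ⟨z, hz1, hz2⟩ := ((accPt_iff_frequently_nhdsNE.1 hy).and_eventually (key y)).exists
  exact hz2 hz1

end TwistedSum

end

/-! ### Real functionals on the first homology of a surface -/

section

open Topology

theorem pathGroupMap_id (X : Type u) [TopologicalSpace X] :
    pathGroupMap (ContinuousMap.id X) = LinearMap.id :=
  pathGroup_hom_ext fun _ _ p => pathGroupMap_pathClass _ p

theorem pathGroupMap_comp {X Y Z : Type u} [TopologicalSpace X] [TopologicalSpace Y]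
    [TopologicalSpace Z] (g : C(Y, Z)) (f : C(X, Y)) :
    pathGroupMap (g.comp f) = pathGroupMap g ∘ₗ pathGroupMap f :=
  pathGroup_hom_ext fun _ _ p => by
    rw [LinearMap.comp_apply, pathGroupMap_pathClass, pathGroupMap_pathClass,
      pathGroupMap_pathClass]
    rfl

/-- The coboundary of a function on points, as a homomorphism on paths. -/
theorem exists_pathGroup_coboundary {X : Type u} [TopologicalSpace X] {A : Type w} [AddCommGroup A]
    [hA : Module ℤ A] (f : X → A) :
    ∃ g : PathGroup X →ₗ[ℤ] A, ∀ (x y : X) (p : Path x y), g (pathClass p) = f y - f x := by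
  obtain ⟨b, hb⟩ := exists_pointChain_lift f
  exact ⟨b ∘ₗ pathBoundary X, fun x y p => by
    rw [LinearMap.comp_apply, pathBoundary_pathClass, map_sub, hb, hb]⟩

theorem exists_injective_rat_to_angle :
    ∃ j : AddCircle (1 : ℚ) →+ Real.Angle, Function.Injective j := by
  let k : ℚ →+ Real.Angle := Real.Angle.coeHom.comp
    ((AddMonoidHom.mulRight (2 * Real.pi)).comp (Rat.castHom ℝ).toAddMonoidHom)
  have hk : ∀ q : ℚ, k q = 0 ↔ q ∈ AddSubgroup.zmultiples (1 : ℚ) := fun q => by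
    change ((q * (2 * Real.pi) : ℝ) : Real.Angle) = ((0 : ℝ) : Real.Angle) ↔ _
    rw [Real.Angle.angle_eq_iff_two_pi_dvd_sub, AddSubgroup.mem_zmultiples_iff]
    refine exists_congr fun n => ?_
    have hpi : 2 * Real.pi ≠ 0 := by positivity
    rw [sub_zero, mul_comm, mul_right_inj' hpi, zsmul_one, eq_comm]
    norm_cast
  refine ⟨QuotientAddGroup.lift _ k fun q hq => (hk q).2 hq, ?_⟩
  rw [injective_iff_map_eq_zero]
  intro x hx
  obtain ⟨q, rfl⟩ := QuotientAddGroup.mk_surjective x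
  exact (QuotientAddGroup.eq_zero_iff q).2 ((hk q).1 hx)

section Lift

variable {S : Type u} [TopologicalSpace S] [ChartedSpace (EuclideanHalfSpace 2) S]
  {ι : Type*} [Fintype ι] {g : PathGroup S →ₗ[ℤ] Real.Angle} {f : ι → S → ℝ}
  {A : ι → S → Real.Angle} {U : ι → Set S}

/-- Off the zeros of a twisted sum `s`, the homomorphism `g` differs from a locally exact one by
the coboundary of the argument of `s`. -/
theorem exists_isLocallyExact (hU : ∀ i, IsOpen (U i)) (hA : ∀ i, IsPotential g (U i) (A i))
    (hf : ∀ i, ContMDiff (𝓡∂ 2) 𝓘(ℝ, ℝ) ∞ (f i)) (hfU : ∀ i, tsupport (f i) ⊆ U i)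
    (hcov : ∀ y, ∃ i, 1 / 2 ≤ f i y) {w : ι → ℂ} {Z : Set S}
    (hZ : ∀ y ∉ Z, twistedSum f A w y ≠ 0) :
    ∃ (G : PathGroup (Zᶜ : Set S) →ₗ[ℤ] Real.Angle) (θ : (Zᶜ : Set S) → Real.Angle),
      IsLocallyExact G ∧ ∀ (x y : (Zᶜ : Set S)) (p : Path x y), G (pathClass p) =
        g (pathClass (p.map continuous_subtype_val)) - (θ y - θ x) := by
  let θ : (Zᶜ : Set S) → Real.Angle := fun y => ((twistedSum f A w y).arg : Real.Angle)
  obtain ⟨b, hb⟩ := exists_pathGroup_coboundary θ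
  let incl : C((Zᶜ : Set S), S) := ⟨Subtype.val, continuous_subtype_val⟩
  have hG : ∀ (x y : (Zᶜ : Set S)) (p : Path x y), (g ∘ₗ pathGroupMap incl - b) (pathClass p) =
      g (pathClass (p.map continuous_subtype_val)) - (θ y - θ x) := fun x y p => by
    rw [LinearMap.sub_apply, hb, LinearMap.comp_apply, pathGroupMap_pathClass]
  refine ⟨g ∘ₗ pathGroupMap incl - b, θ, fun x => ?_, hG⟩
  obtain ⟨i, hi⟩ := hcov x
  let h : S → ℂ := fun y => ∑ j, w j * twistedRatio f A i j y
  let V : Set S := {y | 0 < f i y}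
  have hV : IsOpen V := isOpen_lt continuous_const (hf i).continuous
  have hxV : (x : S) ∈ V := by
    change 0 < f i x
    linarith
  have hne : ∀ y ∈ V, y ∉ Z → h y ≠ 0 := fun y hy hyZ h0 => by
    refine hZ y hyZ ?_
    have hy' : 0 < f i y := hy
    rw [twistedSum_eq hy'.ne', show ∑ j, w j * twistedRatio f A i j y = 0 from h0, mul_zero]
  have hθ : ∀ y : (Zᶜ : Set S), (y : S) ∈ V → θ y = A i y + (h y).arg := fun y hy => by
    have hy' : 0 < f i y := hy
    have h1 := twistedSum_eq (A := A) hy'.ne' w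
    change ((twistedSum f A w y).arg : Real.Angle) = _
    rw [h1, mul_assoc, Complex.arg_real_mul _ hy',
      Complex.arg_mul_coe_angle (Circle.coe_ne_zero _) (hne y hy y.2), Real.Angle.arg_toCircle]
  have hhx := hne x hxV x.2
  have hc : ContinuousAt h x := tendsto_finsetSum _ fun j _ =>
    (continuousAt_const.mul (contMDiffAt_twistedRatio hU hA hf hfU
      (ne_of_gt (show 0 < f i x from hxV)) j).continuousAt)
  refine ⟨Subtype.val ⁻¹' V, continuous_subtype_val.continuousAt.preimage_mem_nhds
    (hV.mem_nhds hxV), fun y => -(h y / h x).arg, ?_, fun y p hp => ?_⟩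
  · have h1 : ContinuousAt (fun y : (Zᶜ : Set S) => h y / h x) x :=
      (hc.comp continuous_subtype_val.continuousAt).div_const _
    have h2 : ContinuousAt Complex.arg (h x / h x) :=
      Complex.continuousAt_arg (by rw [div_self hhx]; exact Complex.one_mem_slitPlane)
    exact (ContinuousAt.comp (f := fun y : (Zᶜ : Set S) => h y / h x) h2 h1).neg
  · have hyV : (y : S) ∈ V := by simpa using hp 1
    have h1 : g (pathClass (p.map continuous_subtype_val)) = A i y - A i x :=
      hA i _ _ _ fun t => hfU i (subset_tsupport _ (ne_of_gt (show 0 < f i (p t) from hp t)))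
    change _ = ((-(h y / h x).arg - -(h x / h x).arg : ℝ) : Real.Angle)
    rw [hG, hθ x hxV, hθ y hyV, h1, div_self hhx, Complex.arg_one, neg_zero, sub_zero,
      Real.Angle.coe_neg, Complex.arg_div_coe_angle (hne y hyV y.2) hhx]
    abel

/-- On a compact connected surface with nonempty boundary, each homomorphism `H₁ → ℝ / 2πℤ` that is
given on paths lifts to a homomorphism `H₁ → ℝ`. -/
theorem exists_H1_lift [IsManifold (𝓡∂ 2) ∞ S] [T2Space S] [CompactSpace S] [PreconnectedSpace S]
    (hbdry : (SurfaceBoundary S).Nonempty) (g : PathGroup S →ₗ[ℤ] Real.Angle) :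
    ∃ Δ : H1 S →ₗ[ℤ] ℝ, ∀ h, ((Δ h : ℝ) : Real.Angle) = g (H1ι S h) := by
  -- Bump functions that cover the surface, with closed supports inside those of larger ones
  have hbasis := fun c : S => @SmoothBumpFunction.nhds_basis_tsupport _ _ _ _ _ (𝓡∂ 2) S _ _ c _ _
  choose F hF using fun c : S => (hbasis c).ex_mem
  have hf : ∀ c : S, ∃ f : SmoothBumpFunction (𝓡∂ 2) c, tsupport f ⊆ Function.support (F c) :=
    fun c => by
      obtain ⟨f, -, hf⟩ := (hbasis c).mem_iff.1
        (F c).support_mem_nhds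
      exact ⟨f, hf⟩
  choose f hf using hf
  choose A hA using fun c => exists_isPotential g (F c)
  obtain ⟨t, ht⟩ := isCompact_univ.elim_finite_subcover (fun c : S => {y | 1 / 2 < f c y})
    (fun c => isOpen_lt continuous_const (f c).continuous) fun c _ =>
      Set.mem_iUnion.2 ⟨c, by change 1 / 2 < f c c; rw [(f c).eq_one]; norm_num⟩
  have hcov : ∀ y, ∃ c : t, 1 / 2 ≤ f c y := fun y => by
    obtain ⟨c, hc, hy⟩ := Set.mem_iUnion₂.1 (ht (Set.mem_univ y))
    exact ⟨⟨c, hc⟩, le_of_lt hy⟩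
  have hU := fun c : t => (F (c : S)).isOpen_support
  obtain ⟨w, hw⟩ := exists_finite_zeros_twistedSum (f := fun c : t => f c) hU (fun c : t => hA c)
    (fun c : t => (f (c : S)).contMDiff) (fun c : t => hf c)
    (fun c : t => by
      rw [extChartAt_source]
      exact (F (c : S)).support_subset_source) hcov
  obtain ⟨Z, hZ, hZ'⟩ : ∃ Z : Set S, Z.Finite ∧
      ∀ y ∉ Z, twistedSum (fun c : t => f c) (fun c : t => A c) w y ≠ 0 := ⟨_, hw, fun y hy => hy⟩
  obtain ⟨G, θ, hG, hGθ⟩ := exists_isLocallyExact (f := fun c : t => f c) hU (fun c : t => hA c)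
    (fun c : t => (f (c : S)).contMDiff) (fun c : t => hf c) hcov hZ'
  obtain ⟨D, hD⟩ := hG.exists_lift
  obtain ⟨x₀, hx₀⟩ := hbdry
  obtain ⟨k, hk, hkZ⟩ := exists_isIsotopic_disjoint hx₀ hZ
  have hk' : ∀ y, k y ∉ Z := fun y => Set.disjoint_left.1 hkZ ⟨y, rfl⟩
  let k' : C(S, (Zᶜ : Set S)) := ⟨fun y => ⟨k y, hk' y⟩, by fun_prop⟩
  refine ⟨D ∘ₗ pathGroupMap k' ∘ₗ H1ι S, fun h => ?_⟩
  rw [LinearMap.comp_apply, hD, LinearMap.comp_apply]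
  have h1 : (G ∘ₗ pathGroupMap k') (H1ι S h) = (g ∘ₗ pathGroupMap k) (H1ι S h) := by
    refine eq_on_H1_of_coboundary (fun y => -θ (k' y)) (fun x y p => ?_) h
    rw [LinearMap.comp_apply, LinearMap.comp_apply, pathGroupMap_pathClass,
      pathGroupMap_pathClass, hGθ]
    change g (pathClass (p.map k.continuous)) - (θ (k' y) - θ (k' x)) =
      g (pathClass (p.map k.continuous)) + _
    abel
  refine h1.trans ?_
  rw [LinearMap.comp_apply, ← pathGroupMap_H1ι_of_homotopic hk.2 h, pathGroupMap_id,
    LinearMap.id_apply]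

/-- The homomorphisms `H₁ → ℝ` of a compact connected surface with nonempty
boundary separate points. -/
theorem exists_H1_real_apply_ne_zero [IsManifold (𝓡∂ 2) ∞ S] [T2Space S] [CompactSpace S]
    [PreconnectedSpace S] (hbdry : (SurfaceBoundary S).Nonempty) {y : H1 S} (hy : y ≠ 0) :
    ∃ Δ : H1 S →ₗ[ℤ] ℝ, Δ y ≠ 0 := by
  obtain ⟨χ, hχ⟩ := CharacterModule.exists_character_apply_ne_zero_of_ne_zero hy
  obtain ⟨χ', rfl⟩ := CharacterModule.dual_surjective_of_injective (H1ι S) H1ι_injective χ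
  obtain ⟨j, hj⟩ := exists_injective_rat_to_angle
  obtain ⟨Δ, hΔ⟩ := exists_H1_lift hbdry
    { toFun := fun c => j (χ' c)
      map_add' := fun a b => by rw [map_add, map_add]
      map_smul' := fun n a => map_intCast_smul (j.comp χ') ℤ ℤ n a }
  refine ⟨Δ, fun h0 => hχ (hj ?_)⟩
  rw [map_zero]
  have := hΔ y
  rw [h0, Real.Angle.coe_zero] at this
  exact this.symm

end Lift

end

/-! ### The boundary of the cylinder -/

section

open Topology

/-- By Lebesgue's number lemma, homomorphisms are equal if they agree on the paths that lie in a
member of an open cover. -/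
theorem pathGroup_hom_ext_of_cover {X : Type u} [TopologicalSpace X] {A : Type w} [AddCommGroup A]
    [hA : Module ℤ A] {f g : PathGroup X →ₗ[ℤ] A} {ι : Type*} {U : ι → Set X}
    (hU : ∀ i, IsOpen (U i)) (hcov : ∀ x, ∃ i, x ∈ U i)
    (h : ∀ (i : ι) (x y : X) (p : Path x y), (∀ t, p t ∈ U i) →
      f (pathClass p) = g (pathClass p)) : f = g := by
  refine pathGroup_hom_ext fun x y p => ?_
  obtain ⟨t, h0, hmono, ⟨n, hn⟩, ht⟩ := exists_monotone_Icc_subset_open_cover_unitInterval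
    (c := fun i => p ⁻¹' U i) (fun i => (hU i).preimage p.continuous) fun a _ => by
      obtain ⟨i, hi⟩ := hcov (p a)
      exact Set.mem_iUnion.2 ⟨i, hi⟩
  have key : ∀ n, f (pathClass (p.subpath 0 (t n))) = g (pathClass (p.subpath 0 (t n))) := by
    intro n
    induction n with
    | zero =>
      rw [h0, Path.subpath_self, pathClass_refl, map_zero, map_zero]
    | succ n ih =>
      have h1 := pathClass_eq_of_homotopic ⟨Path.Homotopy.subpathTransSubpath p 0 (t n) (t (n + 1))⟩
      rw [pathClass_trans] at h1
      obtain ⟨i, hi⟩ := ht n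
      rw [← h1, map_add, map_add, ih, h i _ _ (p.subpath (t n) (t (n + 1))) fun a => ?_]
      have h2 : p.subpath (t n) (t (n + 1)) a ∈ Set.range (p.subpath (t n) (t (n + 1))) := ⟨a, rfl⟩
      rw [Path.range_subpath_of_le _ _ _ (hmono n.le_succ)] at h2
      obtain ⟨b, hb, hba⟩ := h2
      rw [← hba]
      exact hi hb
  have h1 := key n
  rw [hn n le_rfl, Path.subpath_zero_one] at h1
  have h2 : pathClass (p.cast p.source p.target) = pathClass p := pathClass_congr rfl
  rwa [h2] at h1

section Cylinder

variable {S : Type u} [TopologicalSpace S] [ChartedSpace (EuclideanHalfSpace 2) S]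

/-- The projection `∂(Σ × I) → Σ`. -/
def boundaryProj : C(CylinderBoundary S, S) := ⟨fun b => b.1.1, by fun_prop⟩

/-- The class of the boundary of the rectangle `γ × I`, for a path `γ` that joins points of the
boundary of the surface. -/
def rectangle {s₁ s₂ : SurfaceBoundary S} (γ : Path (s₁ : S) (s₂ : S)) :
    PathGroup (CylinderBoundary S) :=
  pathClass (γ.map bottom.continuous) + pathClass (verticalPath s₂) -
    pathClass (γ.map top.continuous) - pathClass (verticalPath s₁)

theorem isOpen_below : IsOpen {b : CylinderBoundary S | b.1.2 < 1} :=
  isOpen_lt (by fun_prop) continuous_const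

theorem isOpen_above : IsOpen {b : CylinderBoundary S | 0 < b.1.2} :=
  isOpen_lt continuous_const (by fun_prop)

/-- The deformation of the complement of the top onto the bottom. -/
def downHomotopy : ContinuousMap.Homotopy
    (⟨Subtype.val, continuous_subtype_val⟩ :
      C({b : CylinderBoundary S | b.1.2 < 1}, CylinderBoundary S))
    ((bottom.comp boundaryProj).comp ⟨Subtype.val, continuous_subtype_val⟩) where
  toFun a := ⟨(a.2.1.1.1, unitInterval.symm a.1 * a.2.1.1.2), by
    rw [mem_cylinderBoundary]
    rcases (mem_cylinderBoundary _ _).1 a.2.1.2 with h | h | h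
    · exact Or.inl h
    · exact Or.inr (Or.inl (by rw [h, mul_zero]))
    · exact absurd h (ne_of_lt a.2.2)⟩
  continuous_toFun := by fun_prop
  map_zero_left b := by simp
  map_one_left b := by simp [bottom, boundaryProj]

/-- The deformation of the complement of the bottom onto the top. -/
def upHomotopy : ContinuousMap.Homotopy
    (⟨Subtype.val, continuous_subtype_val⟩ :
      C({b : CylinderBoundary S | 0 < b.1.2}, CylinderBoundary S))
    ((top.comp boundaryProj).comp ⟨Subtype.val, continuous_subtype_val⟩) where
  toFun a := ⟨(a.2.1.1.1, unitInterval.symm (unitInterval.symm a.1 * unitInterval.symm a.2.1.1.2)),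
    by
    rw [mem_cylinderBoundary]
    rcases (mem_cylinderBoundary _ _).1 a.2.1.2 with h | h | h
    · exact Or.inl h
    · exact absurd h (ne_of_gt a.2.2)
    · exact Or.inr (Or.inr (by rw [h]; simp))⟩
  continuous_toFun := by fun_prop
  map_zero_left b := by simp
  map_one_left b := by simp [top, boundaryProj]

/-- Paths below the top are moved to the bottom. -/
theorem pathClass_add_down {b b' : CylinderBoundary S} (p : Path b b') (hp : ∀ t, (p t).1.2 < 1)
    (hb : b.1.2 < 1) (hb' : b'.1.2 < 1) :
    pathClass p + pathClass (downHomotopy.evalAt ⟨b', hb'⟩) =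
      pathClass (downHomotopy.evalAt ⟨b, hb⟩) +
        pathClass ((p.map boundaryProj.continuous).map bottom.continuous) := by
  let p' : Path (⟨b, hb⟩ : {b : CylinderBoundary S | b.1.2 < 1}) ⟨b', hb'⟩ :=
    ⟨⟨fun t => ⟨p t, hp t⟩, by fun_prop⟩, Subtype.ext p.source, Subtype.ext p.target⟩
  have h1 := pathClass_map_add_evalAt downHomotopy p'
  have e₀ : pathClass (p'.map (⟨Subtype.val, continuous_subtype_val⟩ :
      C({b : CylinderBoundary S | b.1.2 < 1}, CylinderBoundary S)).continuous) = pathClass p :=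
    pathClass_congr (funext fun a => rfl)
  have e₁ : pathClass (p'.map ((bottom.comp boundaryProj).comp
      (⟨Subtype.val, continuous_subtype_val⟩ :
      C({b : CylinderBoundary S | b.1.2 < 1}, CylinderBoundary S))).continuous) =
      pathClass ((p.map boundaryProj.continuous).map bottom.continuous) :=
    pathClass_congr (funext fun a => rfl)
  rwa [e₀, e₁] at h1

/-- Paths above the bottom are moved to the top. -/
theorem pathClass_add_up {b b' : CylinderBoundary S} (p : Path b b') (hp : ∀ t, 0 < (p t).1.2)
    (hb : 0 < b.1.2) (hb' : 0 < b'.1.2) :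
    pathClass p + pathClass (upHomotopy.evalAt ⟨b', hb'⟩) =
      pathClass (upHomotopy.evalAt ⟨b, hb⟩) +
        pathClass ((p.map boundaryProj.continuous).map top.continuous) := by
  let p' : Path (⟨b, hb⟩ : {b : CylinderBoundary S | 0 < b.1.2}) ⟨b', hb'⟩ :=
    ⟨⟨fun t => ⟨p t, hp t⟩, by fun_prop⟩, Subtype.ext p.source, Subtype.ext p.target⟩
  have h1 := pathClass_map_add_evalAt upHomotopy p'
  have e₀ : pathClass (p'.map (⟨Subtype.val, continuous_subtype_val⟩ :
      C({b : CylinderBoundary S | 0 < b.1.2}, CylinderBoundary S)).continuous) = pathClass p :=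
    pathClass_congr (funext fun a => rfl)
  have e₁ : pathClass (p'.map ((top.comp boundaryProj).comp
      (⟨Subtype.val, continuous_subtype_val⟩ :
      C({b : CylinderBoundary S | 0 < b.1.2}, CylinderBoundary S))).continuous) =
      pathClass ((p.map boundaryProj.continuous).map top.continuous) :=
    pathClass_congr (funext fun a => rfl)
  rwa [e₀, e₁] at h1

/-- Over a boundary point of the surface, the ways down and up make up the vertical path. -/
theorem pathClass_down_add_verticalPath {b : CylinderBoundary S} (h₀ : 0 < b.1.2) (h₁ : b.1.2 < 1)
    {s : SurfaceBoundary S} (hs : b.1.1 = s) :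
    pathClass (downHomotopy.evalAt ⟨b, h₁⟩) + pathClass (verticalPath s) =
      pathClass (upHomotopy.evalAt ⟨b, h₀⟩) := by
  have : ContractibleSpace I := (convex_Icc (0 : ℝ) 1).contractibleSpace ⟨0, by simp⟩
  set t := b.1.2 with ht
  let F : C(I, CylinderBoundary S) :=
    ⟨fun t => ⟨((s : S), t), (mem_cylinderBoundary (s : S) t).2 (Or.inl s.2)⟩, by fun_prop⟩
  let q₀ : Path t 0 := ⟨⟨fun a => unitInterval.symm a * t, by fun_prop⟩, by simp, by simp⟩
  let q₁ : Path t 1 := ⟨⟨fun a => unitInterval.symm (unitInterval.symm a * unitInterval.symm t),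
    by fun_prop⟩, by simp, by simp⟩
  let q : Path (0 : I) 1 := ⟨⟨fun a => a, by fun_prop⟩, rfl, rfl⟩
  have h1 := pathClass_eq_of_homotopic
    ((SimplyConnectedSpace.paths_homotopic (q₀.trans q) q₁).map F)
  change pathClass ((Path.trans _ _).map F.continuous) = pathClass (Path.map _ F.continuous) at h1
  rw [Path.map_trans, pathClass_trans] at h1
  have e₀ : pathClass (q₀.map F.continuous) = pathClass (downHomotopy.evalAt ⟨b, h₁⟩) :=
    pathClass_congr (funext fun a => Subtype.ext (Prod.ext hs.symm rfl))
  have e₁ : pathClass (q₁.map F.continuous) = pathClass (upHomotopy.evalAt ⟨b, h₀⟩) :=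
    pathClass_congr (funext fun a => Subtype.ext (Prod.ext hs.symm rfl))
  have e : pathClass (q.map F.continuous) = pathClass (verticalPath s) :=
    pathClass_congr (funext fun a => Subtype.ext (Prod.ext rfl rfl))
  rwa [e₀, e₁, e] at h1

/-- A homomorphism that vanishes on boundaries of rectangles does not change classes in
`H₁(∂(Σ × I))` if these are projected to the bottom. -/
theorem H1ι_eq_of_rectangle_eq_zero [PathConnectedSpace S]
    (hbdry : (SurfaceBoundary S).Nonempty) {A : Type w} [AddCommGroup A] [hA : Module ℤ A]
    (q : PathGroup (CylinderBoundary S) →ₗ[ℤ] A)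
    (hrect : ∀ (s₁ s₂ : SurfaceBoundary S) (γ : Path (s₁ : S) (s₂ : S)), q (rectangle γ) = 0)
    (x : H1 (CylinderBoundary S)) :
    q (H1ι _ x) = q (pathGroupMap bottom (pathGroupMap boundaryProj (H1ι _ x))) := by
  obtain ⟨s, hs⟩ := hbdry
  let s : SurfaceBoundary S := ⟨s, hs⟩
  have hq : ∀ {s₁ s₂ : SurfaceBoundary S} (γ : Path (s₁ : S) (s₂ : S)),
      q (pathClass (γ.map bottom.continuous)) + q (pathClass (verticalPath s₂)) =
        q (pathClass (γ.map top.continuous)) + q (pathClass (verticalPath s₁)) := fun γ => by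
    have := hrect _ _ γ
    rw [rectangle, map_sub, map_sub, map_add, sub_sub, sub_eq_zero] at this
    exact this
  let δ : ∀ y : S, Path y s := fun y => PathConnectedSpace.somePath y s
  -- A potential for the difference of the top and the bottom copy of a path.
  let T : S → A := fun y =>
    q (pathClass ((δ y).map top.continuous)) - q (pathClass ((δ y).map bottom.continuous))
  have hT : ∀ (y y' : S) (γ : Path y y'), q (pathClass (γ.map top.continuous)) =
      q (pathClass (γ.map bottom.continuous)) + T y - T y' := fun y y' γ => by
    have := hq (s₁ := s) (s₂ := s) (((δ y).symm.trans γ).trans (δ y'))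
    simp only [Path.map_trans, pathClass_trans, ← Path.map_symm, pathClass_symm, map_add,
      map_neg] at this
    simp only [T]
    have h2 := add_right_cancel this
    rw [← sub_eq_zero] at h2 ⊢
    rw [← neg_eq_zero, ← h2]
    abel
  classical
  -- The potential for the projection to the bottom: the class of a path from `b` to its projection,
  -- either down or up and around. Both agree modulo the boundary of a rectangle.
  let φ₁ : ∀ b : CylinderBoundary S, 0 < b.1.2 → A :=
    fun b h => q (pathClass (upHomotopy.evalAt ⟨b, h⟩)) + T (boundaryProj b) - q (pathClass (verticalPath s))
  let φ : CylinderBoundary S → A := fun b =>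
    if h : b.1.2 < 1 then q (pathClass (downHomotopy.evalAt ⟨b, h⟩)) else
      φ₁ b (lt_of_lt_of_le one_pos (not_lt.1 h))
  have hφ : ∀ (b : CylinderBoundary S) (h : 0 < b.1.2), φ b = φ₁ b h := fun b h => by
    by_cases h1 : b.1.2 < 1
    · have hb : b.1.1 ∈ SurfaceBoundary S := by
        rcases (mem_cylinderBoundary _ _).1 b.2 with hb | hb | hb
        · exact hb
        · exact absurd hb h.ne'
        · exact absurd hb h1.ne
      have h2 : q (pathClass ((δ (boundaryProj b)).map bottom.continuous)) +
          q (pathClass (verticalPath s)) = q (pathClass ((δ (boundaryProj b)).map top.continuous)) +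
          q (pathClass (verticalPath ⟨b.1.1, hb⟩)) := hq (s₁ := ⟨b.1.1, hb⟩) (s₂ := s) (δ (boundaryProj b))
      simp only [φ, dif_pos h1, φ₁,
        ← pathClass_down_add_verticalPath h h1 (s := ⟨b.1.1, hb⟩) rfl, map_add, T]
      rw [← sub_eq_zero] at h2 ⊢
      rw [← h2]
      abel
    · simp only [φ, dif_neg h1]
  obtain ⟨c, hc⟩ := exists_pathGroup_coboundary fun b => -φ b
  have key : q = q ∘ₗ pathGroupMap bottom ∘ₗ pathGroupMap boundaryProj + c := by
    refine pathGroup_hom_ext_of_cover (ι := Bool) (U := fun i => bif i then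
      {b : CylinderBoundary S | 0 < b.1.2} else {b | b.1.2 < 1}) ?_ ?_ ?_
    · rintro (_ | _)
      exacts [isOpen_below, isOpen_above]
    · intro b
      by_cases h : b.1.2 < 1
      · exact ⟨false, h⟩
      · exact ⟨true, lt_of_lt_of_le one_pos (not_lt.1 h)⟩
    · intro i b b' p hp
      rw [LinearMap.add_apply, hc,
        LinearMap.comp_apply, LinearMap.comp_apply, pathGroupMap_pathClass, pathGroupMap_pathClass]
      cases i with
      | false =>
        have hp' : ∀ t, (p t).1.2 < 1 := hp
        have hb : b.1.2 < 1 := by simpa using hp' 0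
        have hb' : b'.1.2 < 1 := by simpa using hp' 1
        have h1 := congrArg q (pathClass_add_down p hp' hb hb')
        rw [map_add, map_add] at h1
        have e : φ b = q (pathClass (downHomotopy.evalAt ⟨b, hb⟩)) := dif_pos hb
        have e' : φ b' = q (pathClass (downHomotopy.evalAt ⟨b', hb'⟩)) := dif_pos hb'
        rw [e, e', eq_sub_of_add_eq h1]
        abel
      | true =>
        have hp' : ∀ t, 0 < (p t).1.2 := hp
        have hb : 0 < b.1.2 := by simpa using hp' 0
        have hb' : 0 < b'.1.2 := by simpa using hp' 1
        have h1 := congrArg q (pathClass_add_up p hp' hb hb')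
        rw [map_add, map_add, hT] at h1
        rw [hφ b hb, hφ b' hb', eq_sub_of_add_eq h1]
        simp only [φ₁]
        abel
  refine eq_on_H1_of_coboundary (g := q)
    (g' := q ∘ₗ pathGroupMap bottom ∘ₗ pathGroupMap boundaryProj) (fun b => -φ b)
    (fun b b' p => ?_) x
  rw [← hc, ← LinearMap.add_apply, ← key]

end Cylinder

end

/-! ### The second step of the filtration -/

section

open Path.Homotopic (Quotient)

/-- Homomorphisms of abelian groups to rational vector spaces extend, as these are divisible. -/
theorem exists_extension_of_rat {A B V : Type*} [AddCommGroup A] [AddCommGroup B] [Module ℤ A]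
    [Module ℤ B] [AddCommGroup V] [Module ℚ V] (f : A →ₗ[ℤ] B) (hf : Function.Injective f)
    (g : A →ₗ[ℤ] V) : ∃ h : B →ₗ[ℤ] V, ∀ a, h (f a) = g a := by
  let _ : DivisibleBy V ℤ :=
    { div := fun v n => (n : ℚ)⁻¹ • v
      div_zero := fun v => by simp
      div_cancel := fun {n} v hn => by
        have : (n : ℚ) ≠ 0 := by exact_mod_cast hn
        rw [← Int.cast_smul_eq_zsmul ℚ, smul_inv_smul₀ this] }
  obtain ⟨h, hh⟩ := (Module.Baer.of_divisible V).extension_property f hf g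
  exact ⟨h, fun a => LinearMap.congr_fun hh a⟩

section Filtration

variable {X : Type*} [TopologicalSpace X] {x y z : X}

theorem concat_assoc {z' : X} (a : QPi x y) (b : QPi y z) (c : QPi z z') :
    concat x z z' (concat x y z a b) c = concat x y z' a (concat y z z' b c) := by
  induction a using Finsupp.induction_linear with
  | zero => simp
  | add a₁ a₂ h₁ h₂ => simp only [map_add, LinearMap.add_apply, h₁, h₂]
  | single p r =>
    induction b using Finsupp.induction_linear with
    | zero => simp
    | add b₁ b₂ h₁ h₂ => simp only [map_add, LinearMap.add_apply, h₁, h₂]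
    | single q s =>
      induction c using Finsupp.induction_linear with
      | zero => simp
      | add c₁ c₂ h₁ h₂ => simp only [map_add, h₁, h₂]
      | single r' t =>
        simp only [concat_single, Path.Homotopic.Quotient.trans_assoc, mul_assoc]

theorem augmentation_single (p : Quotient x y) (r : ℚ) :
    augmentation x y (Finsupp.single p r) = r := by
  simp [augmentation]

theorem single_sub_single_mem_ker (p q : Quotient x y) :
    Finsupp.single p (1 : ℚ) - Finsupp.single q 1 ∈ LinearMap.ker (augmentation x y) := by
  rw [LinearMap.mem_ker, map_sub, augmentation_single, augmentation_single, sub_self]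

theorem ker_augmentation_eq_span (x : X) : LinearMap.ker (augmentation x x) =
    Submodule.span ℚ (Set.range fun g : Quotient x x =>
      Finsupp.single g (1 : ℚ) - Finsupp.single (Quotient.refl x) 1) := by
  refine le_antisymm (fun a ha => ?_) (Submodule.span_le.2 ?_)
  · have key : ∀ a : QPi x x, a - augmentation x x a • Finsupp.single (Quotient.refl x) 1 ∈
        Submodule.span ℚ (Set.range fun g : Quotient x x =>
          Finsupp.single g (1 : ℚ) - Finsupp.single (Quotient.refl x) 1) := by
      intro a
      induction a using Finsupp.induction_linear with
      | zero => simp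
      | add a b ha hb =>
        rw [map_add, add_smul, add_sub_add_comm]
        exact add_mem ha hb
      | single g r =>
        rw [augmentation_single]
        have : Finsupp.single g r = r • Finsupp.single g (1 : ℚ) := by simp
        rw [this, ← smul_sub]
        exact Submodule.smul_mem _ _ (Submodule.subset_span ⟨g, rfl⟩)
    have := key a
    rwa [LinearMap.mem_ker.1 ha, zero_smul, sub_zero] at this
  · rintro _ ⟨g, rfl⟩
    exact single_sub_single_mem_ker _ _

theorem span_single_eq_top (x y : X) :
    Submodule.span ℚ (Set.range fun p : Quotient x y => Finsupp.single p (1 : ℚ)) = ⊤ := by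
  refine Submodule.eq_top_iff'.2 fun a => ?_
  induction a using Finsupp.induction_linear with
  | zero => exact zero_mem _
  | add a b ha hb => exact add_mem ha hb
  | single g r =>
    have : Finsupp.single g r = r • Finsupp.single g (1 : ℚ) := by simp
    rw [this]
    exact Submodule.smul_mem _ _ (Submodule.subset_span ⟨g, rfl⟩)

theorem filtration_one_eq_span (x y : X) : filtration x y 1 =
    Submodule.span ℚ (Set.range fun a : Quotient x x × Quotient x y =>
      Finsupp.single (a.1.trans a.2) (1 : ℚ) - Finsupp.single a.2 1) := by
  change Submodule.map₂ _ _ ⊤ = _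
  rw [ker_augmentation_eq_span, ← span_single_eq_top, Submodule.map₂_span_span]
  congr 1
  ext a
  simp [concat_single, Set.mem_image2]

/-- `F²` is spanned by the products `(g - 1)(h - 1)p`. -/
theorem filtration_two_eq_span (x y : X) : filtration x y 2 =
    Submodule.span ℚ (Set.range fun a : Quotient x x × Quotient x x × Quotient x y =>
      Finsupp.single (a.1.trans (a.2.1.trans a.2.2)) (1 : ℚ) -
        Finsupp.single (a.2.1.trans a.2.2) 1 -
        (Finsupp.single (a.1.trans a.2.2) 1 - Finsupp.single a.2.2 1)) := by
  change Submodule.map₂ _ _ (filtration x y 1) = _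
  rw [ker_augmentation_eq_span, filtration_one_eq_span, Submodule.map₂_span_span]
  congr 1
  ext a
  simp [concat_single, Set.mem_image2]

theorem mem_filtration_two (g h : Quotient x x) (p : Quotient x y) :
    Finsupp.single (g.trans (h.trans p)) (1 : ℚ) - Finsupp.single (h.trans p) 1 -
      (Finsupp.single (g.trans p) 1 - Finsupp.single p 1) ∈ filtration x y 2 := by
  rw [filtration_two_eq_span]
  exact Submodule.subset_span ⟨(g, h, p), rfl⟩

/-- An element of augmentation zero lies in `F¹`, as all classes of paths are translates of each
other. -/
theorem ker_augmentation_le_filtration_one (c : Quotient x y) :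
    LinearMap.ker (augmentation x y) ≤ filtration x y 1 := by
  intro a ha
  have key : ∀ a : QPi x y, a - augmentation x y a • Finsupp.single c 1 ∈ filtration x y 1 := by
    intro a
    induction a using Finsupp.induction_linear with
    | zero => simp
    | add a b ha hb =>
      rw [map_add, add_smul, add_sub_add_comm]
      exact add_mem ha hb
    | single p r =>
      rw [augmentation_single, filtration_one_eq_span]
      have : Finsupp.single p r = r • Finsupp.single p (1 : ℚ) := by simp
      rw [this, ← smul_sub]
      refine Submodule.smul_mem _ _ (Submodule.subset_span ⟨(p.trans c.symm, c), ?_⟩)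
      simp [Path.Homotopic.Quotient.trans_assoc]
  have := key a
  rwa [LinearMap.mem_ker.1 ha, zero_smul, sub_zero] at this

theorem concat_mem_filtration (n : ℕ) (a : QPi x x) {b : QPi x y} (hb : b ∈ filtration x y n) :
    concat x x y a b ∈ filtration x y n := by
  induction n generalizing b with
  | zero => exact Submodule.mem_top
  | succ n ih =>
    have : filtration x y (n + 1) ≤ (filtration x y (n + 1)).comap (concat x x y a) := by
      refine Submodule.map₂_le.2 fun u hu b hb => ?_
      rw [Submodule.mem_comap, ← concat_assoc]
      refine Submodule.apply_mem_map₂ _ ?_ hb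
      have : LinearMap.ker (augmentation x x) ≤
          (LinearMap.ker (augmentation x x)).comap (concat x x x a) := by
        rw [ker_augmentation_eq_span, Submodule.span_le, ← ker_augmentation_eq_span]
        rintro _ ⟨g, rfl⟩
        rw [SetLike.mem_coe, Submodule.mem_comap]
        clear hu hb u b ih
        induction a using Finsupp.induction_linear with
        | zero => simp
        | add a₁ a₂ h₁ h₂ =>
          rw [map_add, LinearMap.add_apply]
          exact add_mem h₁ h₂
        | single p r =>
          rw [map_sub, concat_single, concat_single, LinearMap.mem_ker, map_sub,
            augmentation_single, augmentation_single, sub_self]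
      exact this hu
    exact this hb

/-- The filtration is multiplicative. -/
theorem concat_mem_filtration_add (m n : ℕ) {a : QPi x x} {b : QPi x y}
    (ha : a ∈ filtration x x m) (hb : b ∈ filtration x y n) :
    concat x x y a b ∈ filtration x y (n + m) := by
  induction m generalizing a with
  | zero => exact concat_mem_filtration n a hb
  | succ m ih =>
    have : filtration x x (m + 1) ≤
        (filtration x y (n + (m + 1))).comap ((concat x x y).flip b) := by
      refine Submodule.map₂_le.2 fun u hu v hv => ?_
      rw [Submodule.mem_comap, LinearMap.flip_apply, concat_assoc]
      exact Submodule.apply_mem_map₂ _ hu (ih hv)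
    exact this ha

end Filtration

section PathGroup

variable {X Y : Type u} [TopologicalSpace X] [TopologicalSpace Y] {x y : X}
  {V : Type*} [AddCommGroup V] [Module ℚ V]

/-- An affine function of the class of a path in `C₁ / B₁` defines a linear map on `ℚπ₁ / F²`. -/
theorem exists_linearMap_of_pathGroup (D : PathGroup X →ₗ[ℤ] V) (v₀ : V) (x y : X) :
    ∃ Φ : QPi x y →ₗ[ℚ] V, filtration x y 2 ≤ LinearMap.ker Φ ∧
      ∀ p : Path x y, Φ (Finsupp.single (Path.Homotopic.Quotient.mk p) 1) = v₀ + D (pathClass p) := by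
  let cls : ∀ {z z' : X}, Quotient z z' → PathGroup X := fun {z z'} =>
    _root_.Quotient.lift pathClass fun _ _ h => pathClass_eq_of_homotopic h
  have htrans : ∀ {z z' z'' : X} (p : Quotient z z') (q : Quotient z' z''),
      cls (p.trans q) = cls p + cls q := fun p q => by
    induction p using Path.Homotopic.Quotient.ind with | mk p =>
    induction q using Path.Homotopic.Quotient.ind with | mk q =>
    exact pathClass_trans p q
  let Φ : QPi x y →ₗ[ℚ] V := Finsupp.linearCombination ℚ fun p => v₀ + D (cls p)
  have hΦ : ∀ p : Quotient x y, Φ (Finsupp.single p 1) = v₀ + D (cls p) := fun p => by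
    simp [Φ]
  refine ⟨Φ, ?_, fun p => hΦ _⟩
  rw [filtration_two_eq_span, Submodule.span_le]
  rintro _ ⟨⟨g, h, p⟩, rfl⟩
  rw [SetLike.mem_coe, LinearMap.mem_ker]
  simp only [map_sub, hΦ, htrans, map_add]
  abel

/-- On a path-connected space, each linear map on `ℚπ₁ / F²` arises from a homomorphism on
`C₁ / B₁`. -/
theorem exists_pathGroup_of_linearMap [PathConnectedSpace X] (μ : QPi x y →ₗ[ℚ] V)
    (hμ : filtration x y 2 ≤ LinearMap.ker μ) :
    ∃ D : PathGroup X →ₗ[ℤ] V, ∀ p q : Path x y, D (pathClass p) - D (pathClass q) =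
      μ (Finsupp.single (Path.Homotopic.Quotient.mk p) 1) - μ (Finsupp.single (Path.Homotopic.Quotient.mk q) 1) := by
  -- paths from the base point, the constant path to the base point itself
  let τ : ∀ z : X, Quotient x z := fun z =>
    (Path.Homotopic.Quotient.mk (PathConnectedSpace.somePath x x)).symm.trans
      (Path.Homotopic.Quotient.mk (PathConnectedSpace.somePath x z))
  have hτ : τ x = Quotient.refl x := Path.Homotopic.Quotient.symm_trans _
  let c := τ y
  let ψ : ∀ z z' : X, Path z z' → V := fun z z' p =>
    μ (Finsupp.single ((((τ z).trans (Path.Homotopic.Quotient.mk p)).trans (τ z').symm).trans c) 1) -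
      μ (Finsupp.single c 1)
  have hμ' : ∀ (g h : Quotient x x) (p : Quotient x y),
      μ (Finsupp.single (g.trans (h.trans p)) 1) - μ (Finsupp.single p 1) =
        (μ (Finsupp.single (g.trans p) 1) - μ (Finsupp.single p 1)) +
        (μ (Finsupp.single (h.trans p) 1) - μ (Finsupp.single p 1)) := fun g h p => by
    have h1 := hμ (mem_filtration_two g h p)
    simp only [LinearMap.mem_ker, map_sub] at h1
    rw [← sub_eq_zero, ← h1]
    abel
  have hψ : ∀ (z z' z'' : X) (p : Path z z') (q : Path z' z''),
      ψ z z'' (p.trans q) = ψ z z' p + ψ z' z'' q := fun z z' z'' p q => by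
    have hc : ∀ b : Quotient z' x, (τ z').symm.trans ((τ z').trans b) = b := fun b => by
      rw [← Path.Homotopic.Quotient.trans_assoc, Path.Homotopic.Quotient.symm_trans,
        Path.Homotopic.Quotient.refl_trans]
    have e : (((τ z).trans (Path.Homotopic.Quotient.mk (p.trans q))).trans (τ z'').symm) =
        (((τ z).trans (Path.Homotopic.Quotient.mk p)).trans (τ z').symm).trans
          (((τ z').trans (Path.Homotopic.Quotient.mk q)).trans (τ z'').symm) := by
      simp only [Path.Homotopic.Quotient.mk_trans, Path.Homotopic.Quotient.trans_assoc, hc]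
    change μ (Finsupp.single (Quotient.trans _ c) 1) - _ = _
    rw [e, Path.Homotopic.Quotient.trans_assoc, hμ']
  obtain ⟨D, hD⟩ := exists_pathGroup_lift ψ hψ fun z z' p q h => by
    simp only [ψ, Path.Homotopic.Quotient.eq.2 h]
  have key : ∀ p : Path x y, D (pathClass p) =
      μ (Finsupp.single (Path.Homotopic.Quotient.mk p) 1) - μ (Finsupp.single c 1) := fun p => by
    rw [hD]
    simp only [ψ, c, hτ, Path.Homotopic.Quotient.trans_assoc,
      Path.Homotopic.Quotient.symm_trans, Path.Homotopic.Quotient.refl_trans,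
      Path.Homotopic.Quotient.trans_refl]
  exact ⟨D, fun p q => by rw [key, key]; abel⟩

/-- The map `ℚπ₁(X, x, y) → ℚπ₁(Y, f x, f y)` induced by a continuous map `f`. -/
def mapPi (f : C(X, Y)) (x y : X) : QPi x y →ₗ[ℚ] QPi (f x) (f y) :=
  Finsupp.lmapDomain ℚ ℚ fun γ => γ.map f

theorem mapPi_single (f : C(X, Y)) (p : Path x y) :
    mapPi f x y (Finsupp.single (Path.Homotopic.Quotient.mk p) 1) =
      Finsupp.single (Path.Homotopic.Quotient.mk (p.map f.continuous)) 1 :=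
  Finsupp.mapDomain_single

theorem exists_H1ι_eq_sub (p q : Path x y) : ∃ h, H1ι X h = pathClass p - pathClass q :=
  exists_H1ι_eq (by rw [map_sub, pathBoundary_pathClass, pathBoundary_pathClass, sub_self])

/-- Paths with the same class in `C₁ / B₁` are congruent modulo `F²`. -/
theorem single_sub_single_mem_filtration_two [PathConnectedSpace X] {p q : Path x y}
    (h : pathClass p = pathClass q) :
    Finsupp.single (Path.Homotopic.Quotient.mk p) (1 : ℚ) - Finsupp.single (Path.Homotopic.Quotient.mk q) 1 ∈
      filtration x y 2 := by
  obtain ⟨D, hD⟩ := exists_pathGroup_of_linearMap (filtration x y 2).mkQ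
    (filtration x y 2).ker_mkQ.ge
  have := hD p q
  rw [h, sub_self, ← map_sub, eq_comm] at this
  exact (Submodule.Quotient.mk_eq_zero _).1 this

/-- If a map is injective on `H₁`, then it is injective on `ℚπ₁ / F²`. -/
theorem comap_filtration_two_le [PathConnectedSpace X] {f : C(X, Y)}
    (hf : Function.Injective (H1map f)) (x y : X) :
    (filtration (f x) (f y) 2).comap (mapPi f x y) ≤ filtration x y 2 := by
  let μ := (filtration x y 2).mkQ
  obtain ⟨D, hD⟩ := exists_pathGroup_of_linearMap μ (filtration x y 2).ker_mkQ.ge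
  obtain ⟨E, hE⟩ := exists_extension_of_rat (pathGroupMap f ∘ₗ H1ι X) (by
    have : ⇑(pathGroupMap f ∘ₗ H1ι X) = H1ι Y ∘ H1map f := funext fun h => (H1ι_H1map f h).symm
    rw [this]
    exact H1ι_injective.comp hf) (D ∘ₗ H1ι X)
  let c : Path x y := PathConnectedSpace.somePath x y
  obtain ⟨Φ, hΦ, hΦp⟩ := exists_linearMap_of_pathGroup E
    (μ (Finsupp.single (Path.Homotopic.Quotient.mk c) 1) - E (pathClass (c.map f.continuous))) (f x) (f y)
  have key : Φ ∘ₗ mapPi f x y = μ := by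
    refine LinearMap.ext_on (span_single_eq_top x y) ?_
    rintro _ ⟨p, rfl⟩
    induction p using Path.Homotopic.Quotient.ind with | mk p =>
    change Φ (mapPi f x y (Finsupp.single (Path.Homotopic.Quotient.mk p) 1)) = _
    obtain ⟨h, hh⟩ := exists_H1ι_eq_sub p c
    have h2 := hE h
    rw [LinearMap.comp_apply, LinearMap.comp_apply, hh, map_sub, map_sub, map_sub, hD,
      pathGroupMap_pathClass, pathGroupMap_pathClass] at h2
    rw [mapPi_single, hΦp, sub_add, sub_eq_iff_eq_add, ← sub_eq_iff_eq_add', ← neg_sub, ← h2]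
    abel
  intro a ha
  rw [← (filtration x y 2).ker_mkQ, LinearMap.mem_ker]
  change μ a = 0
  rw [← key]
  exact hΦ ha

end PathGroup

end

/-! ### Maps that are surjective on first homology -/

section

open Path.Homotopic (Quotient)

section Surjective

variable {X Y : Type u} [TopologicalSpace X] [TopologicalSpace Y]

/-- In a path-connected space, each class in `H₁` is represented by a loop at a given point. -/
theorem exists_loop_of_H1 [PathConnectedSpace X] (x : X) (h : H1 X) :
    ∃ p : Path x x, H1ι X h = pathClass p := by
  let Λ : AddSubgroup (PathGroup X) :=
    { carrier := {c | ∃ p : Path x x, c = pathClass p}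
      zero_mem' := ⟨Path.refl x, (pathClass_refl x).symm⟩
      add_mem' := by
        rintro _ _ ⟨p, rfl⟩ ⟨q, rfl⟩
        exact ⟨p.trans q, (pathClass_trans p q).symm⟩
      neg_mem' := by
        rintro _ ⟨p, rfl⟩
        exact ⟨p.symm, (pathClass_symm p).symm⟩ }
  let Λ' : Submodule ℤ (PathGroup X) :=
    { Λ with
      smul_mem' := fun n c hc =>
        (congrArg (· ∈ Λ) (int_smul_eq_zsmul (PathGroup X).isModule n c)).mpr (Λ.zsmul_mem hc n) }
  let τ : ∀ z : X, Path x z := fun z => PathConnectedSpace.somePath x z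
  -- Each path is closed up to a loop.
  obtain ⟨b, hb⟩ := exists_pathGroup_coboundary fun z => -pathClass (τ z)
  let a : PathGroup X →ₗ[ℤ] PathGroup X := LinearMap.id + b
  have h1 : ∀ c, a c ∈ Λ' := by
    have : ⊤ ≤ Λ'.comap a := by
      rw [← span_pathClass, Submodule.span_le]
      rintro _ ⟨z, z', p, rfl⟩
      refine ⟨((τ z).trans p).trans (τ z').symm, ?_⟩
      change pathClass p + b (pathClass p) = _
      rw [hb, pathClass_trans, pathClass_trans, pathClass_symm]
      abel
    exact fun c => this Submodule.mem_top
  have h2 : a (H1ι X h) = H1ι X h :=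
    eq_on_H1_of_coboundary (g := a) (g' := LinearMap.id) (fun z => -pathClass (τ z)) (fun z z' p => by
      rw [← hb]; rfl) h
  obtain ⟨p, hp⟩ := h1 (H1ι X h)
  exact ⟨p, h2.symm.trans hp⟩

theorem mapPi_concat (f : C(X, Y)) (x y : X) (a : QPi x x) (b : QPi x y) :
    mapPi f x y (concat x x y a b) =
      concat (f x) (f x) (f y) (mapPi f x x a) (mapPi f x y b) :=
  lmapDomain_concat _ _ (fun p q => by
    induction p using Path.Homotopic.Quotient.ind with | mk p =>
    induction q using Path.Homotopic.Quotient.ind with | mk q =>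
    exact congrArg Path.Homotopic.Quotient.mk (p.map_trans q f.continuous)) a b

theorem augmentation_comp_mapPi (f : C(X, Y)) (x y : X) :
    (augmentation (f x) (f y)).comp (mapPi f x y) = augmentation x y :=
  augmentation_comp_lmapDomain _

theorem filtration_le_comap_mapPi (f : C(X, Y)) (x y : X) (n : ℕ) :
    filtration x y n ≤ (filtration (f x) (f y) n).comap (mapPi f x y) :=
  filtration_le_comap (mapPi f x x) _ (augmentation_comp_mapPi f x x) (mapPi_concat f x y) n

theorem completionMap_val {x y : X} {x' y' : Y} {φ : QPi x y →ₗ[ℚ] QPi x' y'}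
    {hφ : ∀ n, filtration x y n ≤ (filtration x' y' n).comap φ} {v : Completion x y} {n : ℕ}
    {a : QPi x y} (ha : (filtration x y n).mkQ a = v.1 n) :
    (filtration x' y' n).mkQ (φ a) = (completionMap φ hφ v).1 n := by
  change _ = Submodule.mapQ _ _ φ (hφ n) (v.1 n)
  rw [← ha]
  rfl

theorem inducedMap_val (f : C(X, Y)) {x y : X} {v : Completion x y} {n : ℕ} {a : QPi x y}
    (ha : (filtration x y n).mkQ a = v.1 n) :
    (filtration (f x) (f y) n).mkQ (mapPi f x y a) = (inducedMap f x y v).1 n :=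
  completionMap_val ha

theorem changeBase_val {x y x' y' : X} (p : Path x x') (q : Path y y') {v : Completion x y} {n : ℕ}
    {a : QPi x y} (ha : (filtration x y n).mkQ a = v.1 n) :
    (filtration x' y' n).mkQ (Finsupp.lmapDomain ℚ ℚ (fun γ : Quotient x y =>
      ((Path.Homotopic.Quotient.mk p.symm).trans γ).trans (Path.Homotopic.Quotient.mk q)) a) =
        (changeBase p q v).1 n :=
  completionMap_val ha

variable [PathConnectedSpace X] [PathConnectedSpace Y] {f : C(X, Y)}

/-- If a map is surjective on `H₁`, then it is surjective on the quotient of the filtration in degree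
one. -/
theorem ker_augmentation_le_map_sup (hf : Function.Surjective (H1map f)) (x : X) :
    LinearMap.ker (augmentation (f x) (f x)) ≤
      (LinearMap.ker (augmentation x x)).map (mapPi f x x) ⊔ filtration (f x) (f x) 2 := by
  rw [ker_augmentation_eq_span, Submodule.span_le]
  rintro _ ⟨g, rfl⟩
  induction g using Path.Homotopic.Quotient.ind with | mk p =>
  obtain ⟨k, hk⟩ := exists_H1ι_eq_pathClass p
  obtain ⟨h, rfl⟩ := hf k
  obtain ⟨q, hq⟩ := exists_loop_of_H1 x h
  rw [H1ι_H1map, hq, pathGroupMap_pathClass] at hk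
  have hrefl : (Path.refl x).map f.continuous = Path.refl (f x) := rfl
  refine Submodule.mem_sup.2 ⟨mapPi f x x (Finsupp.single (Path.Homotopic.Quotient.mk q) 1 -
    Finsupp.single (Path.Homotopic.Quotient.mk (Path.refl x)) 1),
    Submodule.mem_map_of_mem (single_sub_single_mem_ker _ _), _,
    single_sub_single_mem_filtration_two hk.symm, ?_⟩
  rw [map_sub, mapPi_single, mapPi_single, hrefl, Path.Homotopic.Quotient.mk_refl]
  exact sub_add_sub_cancel' _ _ _

/-- If a map is surjective on `H₁`, then it is surjective on the graded quotients of the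
filtration, as these are generated by the quotient in degree one. -/
theorem filtration_le_map_sup (hf : Function.Surjective (H1map f)) (x y : X) (n : ℕ) :
    filtration (f x) (f y) n ≤
      (filtration x y n).map (mapPi f x y) ⊔ filtration (f x) (f y) (n + 1) := by
  induction n with
  | zero =>
    change ⊤ ≤ _
    rw [← span_single_eq_top, Submodule.span_le]
    rintro _ ⟨p, rfl⟩
    let c : Path x y := PathConnectedSpace.somePath x y
    let c' := Path.Homotopic.Quotient.mk (c.map f.continuous)
    refine Submodule.mem_sup.2 ⟨mapPi f x y (Finsupp.single (Path.Homotopic.Quotient.mk c) 1),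
      Submodule.mem_map_of_mem Submodule.mem_top, Finsupp.single p 1 - Finsupp.single c' 1,
      ker_augmentation_le_filtration_one c' (single_sub_single_mem_ker _ _), ?_⟩
    rw [mapPi_single]
    abel
  | succ n ih =>
    refine Submodule.map₂_le.2 fun a ha b hb => ?_
    obtain ⟨_, ⟨a', ha', rfl⟩, a'', ha'', rfl⟩ :=
      Submodule.mem_sup.1 (ker_augmentation_le_map_sup hf x ha)
    obtain ⟨_, ⟨b', hb', rfl⟩, b'', hb'', rfl⟩ := Submodule.mem_sup.1 (ih hb)
    refine Submodule.mem_sup.2 ⟨mapPi f x y (concat x x y a' b'), Submodule.mem_map_of_mem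
      (Submodule.apply_mem_map₂ _ ha' hb'), concat _ _ _ a'' (mapPi f x y b') +
        concat _ _ _ (mapPi f x x a' + a'') b'', add_mem ?_ ?_, ?_⟩
    · exact concat_mem_filtration_add 2 n ha'' (filtration_le_comap_mapPi f x y n hb')
    · exact Submodule.apply_mem_map₂ _ ha hb''
    · rw [mapPi_concat]
      simp only [map_add, LinearMap.add_apply]
      abel

/-- The part of Stallings' theorem that follows from surjectivity on `H₁`. -/
theorem inducedMap_surjective (hf : Function.Surjective (H1map f)) (x y : X) :
    Function.Surjective (inducedMap f x y) := by
  rintro ⟨w, hw⟩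
  have hw' : ∀ m n (h : m ≤ n), Submodule.factor (filtration_antitone _ _ h) (w n) = w m := hw
  -- Representatives are improved step by step.
  have step : ∀ n (a : QPi x y), (filtration (f x) (f y) n).mkQ (mapPi f x y a) = w n →
      ∃ a', (filtration (f x) (f y) (n + 1)).mkQ (mapPi f x y a') = w (n + 1) ∧
        a' - a ∈ filtration x y n := by
    intro n a ha
    obtain ⟨b, hb⟩ := Submodule.mkQ_surjective _ (w (n + 1))
    have h1 : b - mapPi f x y a ∈ filtration (f x) (f y) n := by
      rw [← Submodule.ker_mkQ (filtration (f x) (f y) n), LinearMap.mem_ker, map_sub, ha,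
        ← hw' n (n + 1) n.le_succ, ← hb, sub_eq_zero]
      rfl
    obtain ⟨_, ⟨c, hc, rfl⟩, d, hd, hcd⟩ := Submodule.mem_sup.1 (filtration_le_map_sup hf x y n h1)
    refine ⟨a + c, ?_, by rwa [add_sub_cancel_left]⟩
    rw [← hb, ← sub_eq_zero, ← map_sub, ← LinearMap.mem_ker, Submodule.ker_mkQ, map_add,
      ← neg_mem_iff]
    convert hd using 1
    rw [neg_sub, ← sub_sub, ← hcd, add_sub_cancel_left]
  choose! next hnext hsub using step
  let s : ℕ → QPi x y := fun n => Nat.rec 0 (fun n a => next n a) n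
  have hs : ∀ n, (filtration (f x) (f y) n).mkQ (mapPi f x y (s n)) = w n := by
    intro n
    induction n with
    | zero =>
      have : Subsingleton (QPi (f x) (f y) ⧸ filtration (f x) (f y) 0) :=
        Submodule.Quotient.subsingleton_iff.2 rfl
      exact Subsingleton.elim _ _
    | succ n ih => exact hnext n _ ih
  have hcomp : ∀ m n, m ≤ n → s n - s m ∈ filtration x y m := by
    intro m n h
    induction n, h using Nat.le_induction with
    | base => rw [sub_self]; exact zero_mem _
    | succ n h ih =>
      rw [← sub_add_sub_cancel _ (s n)]
      exact add_mem (filtration_antitone x y h (hsub n _ (hs n))) ih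
  refine ⟨⟨fun n => (filtration x y n).mkQ (s n), fun m n h => ?_⟩, ?_⟩
  · exact (Submodule.Quotient.eq _).2 (hcomp m n h)
  · exact Subtype.ext (funext hs)

end Surjective

section Separation

variable {X : Type u} [TopologicalSpace X] {x y : X}

/-- If the homomorphisms `H₁ → ℝ` separate points, then paths which are congruent modulo `F²` have
the same class in `C₁ / B₁`. -/
theorem pathClass_eq_of_mem_filtration_two (hX : ∀ h : H1 X, h ≠ 0 → ∃ Δ : H1 X →ₗ[ℤ] ℝ, Δ h ≠ 0)
    {p q : Path x y} (hpq : Finsupp.single (Path.Homotopic.Quotient.mk p) (1 : ℚ) -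
      Finsupp.single (Path.Homotopic.Quotient.mk q) 1 ∈ filtration x y 2) :
    pathClass p = pathClass q := by
  obtain ⟨h, hh⟩ := exists_H1ι_eq_sub p q
  by_contra hne
  obtain ⟨Δ, hΔ⟩ := hX h fun h0 => hne (by rw [← sub_eq_zero, ← hh, h0, map_zero])
  obtain ⟨E, hE⟩ := exists_extension_of_rat (H1ι X) H1ι_injective Δ
  obtain ⟨Φ, hΦ, hΦp⟩ := exists_linearMap_of_pathGroup E 0 x y
  have h1 := hΦ hpq
  rw [LinearMap.mem_ker, map_sub, hΦp, hΦp, zero_add, zero_add, ← map_sub, ← hh, hE] at h1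
  exact hΔ h1

end Separation

end

/-! ### The action of a homology cobordism -/

section

open Path.Homotopic (Quotient)

section Cobordism

variable {S M : Type u} [TopologicalSpace S] [ChartedSpace (EuclideanHalfSpace 2) S]
  [TopologicalSpace M] [ChartedSpace (EuclideanHalfSpace 3) M]
  {α : CylinderBoundary S ≃ₜ ThreeManifoldBoundary M}

/-- If boundaries of rectangles vanish in `Y`, then a map `∂(Σ × I) → Y` that is injective on the
`H₁` of the bottom has the same kernel on `H₁` as the projection to `Σ`. -/
theorem ker_H1map_eq [PathConnectedSpace S] (hbdry : (SurfaceBoundary S).Nonempty) {Y : Type u}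
    [TopologicalSpace Y] {f : C(CylinderBoundary S, Y)}
    (hf : Function.Injective (H1map (f.comp bottom)))
    (hrect : ∀ (s₁ s₂ : SurfaceBoundary S) (γ : Path (s₁ : S) (s₂ : S)),
      pathGroupMap f (rectangle γ) = 0) :
    LinearMap.ker (H1map f) = LinearMap.ker (H1map (boundaryProj (S := S))) := by
  have key : ∀ x, H1map f x = H1map (f.comp bottom) (H1map boundaryProj x) := fun x => by
    apply H1ι_injective
    rw [H1ι_H1map, H1ι_H1map, H1ι_H1map, H1ι_eq_of_rectangle_eq_zero hbdry (pathGroupMap f) hrect,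
      pathGroupMap_comp]
    rfl
  ext x
  rw [LinearMap.mem_ker, LinearMap.mem_ker, key, map_eq_zero_iff _ hf]

theorem pathGroupMap_inclusion_rectangle {s₁ s₂ : SurfaceBoundary S}
    (γ : Path (s₁ : S) (s₂ : S)) : pathGroupMap inclusion (rectangle γ) = 0 := by
  -- the homotopy from the bottom to the top
  let H : ContinuousMap.Homotopy ((inclusion (S := S)).comp bottom) (inclusion.comp top) :=
    { toFun := fun a => (a.2, a.1)
      continuous_toFun := by fun_prop
      map_zero_left := fun _ => rfl
      map_one_left := fun _ => rfl }
  have h1 := pathClass_map_add_evalAt H γ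
  rw [rectangle, map_sub, map_sub, map_add, sub_sub, sub_eq_zero]
  simp only [pathGroupMap_pathClass]
  have e : ∀ s : SurfaceBoundary S, pathClass (H.evalAt (s : S)) =
      pathClass ((verticalPath s).map inclusion.continuous) := fun s => pathClass_congr rfl
  rw [e, e, add_comm (pathClass ((verticalPath s₁).map _))] at h1
  exact h1

theorem injective_H1map_inclusion_comp_bottom :
    Function.Injective (H1map ((inclusion (S := S)).comp bottom)) := by
  refine Function.LeftInverse.injective (g := H1map (⟨Prod.fst, continuous_fst⟩ : C(S × I, S)))
    fun h => H1ι_injective ?_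
  rw [H1ι_H1map, H1ι_H1map, ← LinearMap.comp_apply, ← pathGroupMap_comp]
  exact LinearMap.congr_fun (pathGroupMap_id S) _

theorem exists_H1ι_eq_rectangle {s₁ s₂ : SurfaceBoundary S} (γ : Path (s₁ : S) (s₂ : S)) :
    ∃ h, H1ι _ h = rectangle γ := by
  refine exists_H1ι_eq ?_
  simp only [rectangle, map_sub, map_add, pathBoundary_pathClass]
  abel

/-- The kernels of `ι_*` and `α_*` agree if and only if boundaries of rectangles vanish in `M`. -/
theorem ker_eq_ker_iff [PathConnectedSpace S] (hbdry : (SurfaceBoundary S).Nonempty)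
    (hα : IsHomologyCobordism α) :
    LinearMap.ker (H1map (inclusion (S := S))) = LinearMap.ker (H1map (boundaryMap α)) ↔
      ∀ (s₁ s₂ : SurfaceBoundary S) (γ : Path (s₁ : S) (s₂ : S)),
        pathGroupMap (boundaryMap α) (rectangle γ) = 0 := by
  constructor
  · intro h s₁ s₂ γ
    obtain ⟨x, hx⟩ := exists_H1ι_eq_rectangle γ
    have h1 : x ∈ LinearMap.ker (H1map (inclusion (S := S))) := by
      rw [LinearMap.mem_ker, ← map_eq_zero_iff _ H1ι_injective, H1ι_H1map, hx,
        pathGroupMap_inclusion_rectangle]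
    rw [h, LinearMap.mem_ker] at h1
    rw [← hx, ← H1ι_H1map, h1, map_zero]
  · intro h
    rw [ker_H1map_eq hbdry injective_H1map_inclusion_comp_bottom
      fun _ _ γ => pathGroupMap_inclusion_rectangle γ, ker_H1map_eq hbdry hα.1.1 h]

/-- The path `γ₁₀ α₀(γ) γ₀₁`. -/
def conjPath (α : CylinderBoundary S ≃ₜ ThreeManifoldBoundary M) {s₁ s₂ : SurfaceBoundary S}
    (γ : Path (s₁ : S) (s₂ : S)) : Path (topMap α (s₁ : S)) (topMap α (s₂ : S)) :=
  ((gamma α s₁).symm.trans (γ.map (bottomMap α).continuous)).trans (gamma α s₂)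

theorem pathGroupMap_boundaryMap_rectangle {s₁ s₂ : SurfaceBoundary S}
    (γ : Path (s₁ : S) (s₂ : S)) : pathGroupMap (boundaryMap α) (rectangle γ) =
      pathClass (conjPath α γ) - pathClass (γ.map (topMap α).continuous) := by
  rw [conjPath, pathClass_trans, pathClass_trans, pathClass_symm, rectangle]
  simp only [map_sub, map_add, pathGroupMap_pathClass]
  change pathClass (γ.map (bottomMap α).continuous) + pathClass (gamma α s₂) -
    pathClass (γ.map (topMap α).continuous) - pathClass (gamma α s₁) = _
  abel

/-- The linear extension of `γ ↦ γ₁₀ α₀(γ) γ₀₁`. -/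
def conjPi (α : CylinderBoundary S ≃ₜ ThreeManifoldBoundary M) (s₁ s₂ : SurfaceBoundary S) :
    QPi (s₁ : S) (s₂ : S) →ₗ[ℚ] QPi (topMap α (s₁ : S)) (topMap α (s₂ : S)) :=
  (Finsupp.lmapDomain ℚ ℚ fun γ => ((Path.Homotopic.Quotient.mk (gamma α s₁).symm).trans γ).trans
    (Path.Homotopic.Quotient.mk (gamma α s₂))) ∘ₗ mapPi (bottomMap α) s₁ s₂

theorem conjPi_single {s₁ s₂ : SurfaceBoundary S} (γ : Path (s₁ : S) (s₂ : S)) :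
    conjPi α s₁ s₂ (Finsupp.single (Path.Homotopic.Quotient.mk γ) 1) =
      Finsupp.single (Path.Homotopic.Quotient.mk (conjPath α γ)) 1 := by
  rw [conjPi, LinearMap.comp_apply, mapPi_single]
  exact Finsupp.mapDomain_single

/-- The action is congruent to the identity modulo `F²` if and only if `γ₁₀ α₀(γ) γ₀₁` and `α₁(γ)`
are congruent modulo `F²` for all paths `γ`. -/
theorem action_sub_mem_iff [PathConnectedSpace S] [PathConnectedSpace M]
    (hα : IsHomologyCobordism α) (s₁ s₂ : SurfaceBoundary S) :
    (∀ v : Completion (s₁ : S) (s₂ : S),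
      action α s₁ s₂ v - v ∈ completionFiltration (s₁ : S) (s₂ : S) 2) ↔
      ∀ γ : Path (s₁ : S) (s₂ : S),
        Finsupp.single (Path.Homotopic.Quotient.mk (conjPath α γ)) (1 : ℚ) -
          Finsupp.single (Path.Homotopic.Quotient.mk (γ.map (topMap α).continuous)) 1 ∈
            filtration (topMap α (s₁ : S)) (topMap α (s₂ : S)) 2 := by
  set F := filtration (topMap α (s₁ : S)) (topMap α (s₂ : S)) 2
  have key : ∀ (v : Completion (s₁ : S) (s₂ : S)) (a : QPi (s₁ : S) (s₂ : S)),
      (filtration (s₁ : S) (s₂ : S) 2).mkQ a = v.1 2 →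
      (action α s₁ s₂ v - v ∈ completionFiltration (s₁ : S) (s₂ : S) 2 ↔
        conjPi α s₁ s₂ a - mapPi (topMap α) s₁ s₂ a ∈ F) := by
    intro v a ha
    have h1 : inducedMap (topMap α) (s₁ : S) (s₂ : S) (action α s₁ s₂ v) =
        changeBase (gamma α s₁) (gamma α s₂) (inducedMap (bottomMap α) (s₁ : S) (s₂ : S) v) :=
      Function.invFun_eq (inducedMap_surjective hα.2.2 _ _ _)
    obtain ⟨b, hb⟩ := Submodule.mkQ_surjective _ ((action α s₁ s₂ v).1 2)
    have h2 := congrFun (congrArg Subtype.val h1) 2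
    have h3 : F.mkQ (mapPi (topMap α) s₁ s₂ b) = F.mkQ (conjPi α s₁ s₂ a) := by
      refine (inducedMap_val (topMap α) hb).trans (h2.trans (Eq.symm ?_))
      exact changeBase_val (gamma α s₁) (gamma α s₂) (inducedMap_val (bottomMap α) ha)
    have h4 : mapPi (topMap α) s₁ s₂ b - conjPi α s₁ s₂ a ∈ F :=
      (Submodule.Quotient.eq _).1 h3
    have h5 : action α s₁ s₂ v - v ∈ completionFiltration (s₁ : S) (s₂ : S) 2 ↔
        b - a ∈ filtration (s₁ : S) (s₂ : S) 2 := by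
      change (action α s₁ s₂ v).1 2 - v.1 2 = 0 ↔ _
      rw [← hb, ← ha, ← map_sub, ← LinearMap.mem_ker, Submodule.ker_mkQ]
    have h6 : b - a ∈ filtration (s₁ : S) (s₂ : S) 2 ↔ mapPi (topMap α) s₁ s₂ (b - a) ∈ F :=
      ⟨fun h => filtration_le_comap_mapPi _ _ _ 2 h,
        fun h => comap_filtration_two_le hα.2.1 _ _ h⟩
    rw [h5, h6, map_sub, ← Submodule.add_mem_iff_right F (neg_mem h4)]
    congr! 1
    abel
  constructor
  · intro h γ
    have := (key ⟨fun n => (filtration _ _ n).mkQ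
      (Finsupp.single (Path.Homotopic.Quotient.mk γ) 1), fun m n h => rfl⟩ _ rfl).1 (h _)
    rwa [conjPi_single, mapPi_single] at this
  · intro h v
    obtain ⟨a, ha⟩ := Submodule.mkQ_surjective _ (v.1 2)
    refine (key v a ha).2 ?_
    have h1 : a ∈ Submodule.span ℚ (Set.range fun p : Quotient (s₁ : S) (s₂ : S) =>
        Finsupp.single p (1 : ℚ)) := by
      rw [span_single_eq_top]
      exact Submodule.mem_top
    have h2 : Submodule.span ℚ (Set.range fun p : Quotient (s₁ : S) (s₂ : S) =>
        Finsupp.single p (1 : ℚ)) ≤ F.comap (conjPi α s₁ s₂ - mapPi (topMap α) s₁ s₂) := by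
      rw [Submodule.span_le]
      rintro _ ⟨p, rfl⟩
      induction p using Path.Homotopic.Quotient.ind with | mk p =>
      rw [SetLike.mem_coe, Submodule.mem_comap, LinearMap.sub_apply, conjPi_single, mapPi_single]
      exact h p
    exact h2 h1

end Cobordism

end

end HomologyCobordism

end

open HomologyCobordism in
theorem proposition4p2 {S M : Type u}
    [TopologicalSpace S] [ChartedSpace (EuclideanHalfSpace 2) S] [IsManifold (𝓡∂ 2) ∞ S]
    [T2Space S] [CompactSpace S] [ConnectedSpace S]
    (hS : IsOrientable 2 S) (hbdry : (SurfaceBoundary S).Nonempty)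
    [TopologicalSpace M] [ChartedSpace (EuclideanHalfSpace 3) M] [IsManifold (𝓡∂ 3) ∞ M]
    [T2Space M] [CompactSpace M] [ConnectedSpace M]
    (hM : IsOrientable 3 M)
    (α : CylinderBoundary S ≃ₜ ThreeManifoldBoundary M) (hα : IsHomologyCobordism α) :
    LinearMap.ker (H1map (inclusion (S := S))) = LinearMap.ker (H1map (boundaryMap α)) ↔
      ∀ (s₁ s₂ : SurfaceBoundary S) (v : Completion (s₁ : S) (s₂ : S)),
        action α s₁ s₂ v - v ∈ completionFiltration (s₁ : S) (s₂ : S) 2 := by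
  have : LocallyPathConnectedSpace S :=
    ChartedSpace.locallyPathConnectedSpace (EuclideanHalfSpace 2) S
  have : LocallyPathConnectedSpace M :=
    ChartedSpace.locallyPathConnectedSpace (EuclideanHalfSpace 3) M
  have : PathConnectedSpace S := PathConnectedSpace.of_locallyPathConnectedSpace
  have : PathConnectedSpace M := PathConnectedSpace.of_locallyPathConnectedSpace
  -- The separation of points is transported from `Σ` to `M` along `α₀`.
  have hsep : ∀ h : H1 M, h ≠ 0 → ∃ Δ : H1 M →ₗ[ℤ] ℝ, Δ h ≠ 0 := fun h hh => by
    let e := LinearEquiv.ofBijective (H1map (bottomMap α)) hα.1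
    obtain ⟨Δ, hΔ⟩ := exists_H1_real_apply_ne_zero hbdry (y := e.symm h)
      (e.symm.map_ne_zero_iff.2 hh)
    exact ⟨Δ ∘ₗ e.symm.toLinearMap, hΔ⟩
  rw [ker_eq_ker_iff hbdry hα]
  refine forall₂_congr fun s₁ s₂ => ?_
  rw [action_sub_mem_iff hα]
  refine forall_congr' fun γ => ?_
  rw [pathGroupMap_boundaryMap_rectangle, sub_eq_zero]
  exact ⟨fun h => single_sub_single_mem_filtration_two h,
    fun h => pathClass_eq_of_mem_filtration_two hsep h⟩
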